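/- \textbf{Setting.} Let $N\ge 1$, let $k$ be a field and let $q,q_N,\kappa_N,\zeta_N\in k\setminus\{0\}$; for type BI below, $q_N=q^M$ with an integer $M\ge1$. Let $V^{\otimes N}$ ($V=k v_+\oplus k v_-$) have the basis $v_\epsilon$, $\epsilon\in\{+,-\}^N$. For $1\le i\le N-1$ let $e_i$ act on the tensor factors $i,i+1$ by $v_{++},v_{--}\mapsto 0$, $v_{+-}\mapsto -q^{-1}v_{+-}+v_{-+}$, $v_{-+}\mapsto v_{+-}-q\,v_{-+}$, and let $e_N$ act on the last factor by $v_+\mapsto -q_N^{-1}v_++\kappa_N^{-1}v_-$, $v_-\mapsto \kappa_N v_+-q_N v_-$. Put $T_i=e_i+q_i^{-1}$ with $q_1=\dots=q_{N-1}=q$. Strings are ordered lexicographically, $\beta>\alpha$ meaning that $\beta_j=-$, $\alpha_j=+$ at the first place $j$ where they differ; letters are compared by $-<+$. \textbf{Kazhdan--Lusztig bases.} Over the Laurent polynomials in $q,q_N,\kappa_N$ (in $q,\kappa_N$ for type BI) the bar involution of $V^{\otimes N}$ is semilinear for $\bar q=q^{-1}$, $\bar q_N=q_N^{-1}$, $\bar\kappa_N=\kappa_N$,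 fixes $v_{+\cdots+}$, and satisfies $\overline{T_i v}=T_i^{-1}\bar v$ for $1\le i\le N$. The Kazhdan--Lusztig basis $(C_\epsilon)$ of type $X\in\{\mathrm{BI},\mathrm{BII},\mathrm{BIII}\}$ is determined by $\overline{C_\epsilon}=C_\epsilon$ and $C_\epsilon\in v_\epsilon+\sum_{\epsilon'<\epsilon}\mathbb Z A_-^{X}\,v_{\epsilon'}$, where $\mathbb ZA_-^X$ is the $\mathbb Z$-span of $A_-^{\mathrm{BI}}=\{q^i\kappa_N^l: i<0,l\ge0\}$, of $A_-^{\mathrm{BII}}=\{q^iq_N^j\kappa_N^l: l\ge0,\ i<0\text{ or }(i=0,j<0)\}$, respectively of $A_-^{\mathrm{BIII}}=\{q^iq_N^j\kappa_N^l: l\ge0,\ j<0\text{ or }(j=0,i<0)\}$. The same symbols denote the vectors over $k$ obtained by substituting the values of the parameters. Let $c^i_{\alpha\beta}$ be the coefficient of $C_\alpha$ in $e_iC_\beta$. \textbf{Operators.} Let $s_i\mathbf z$ ($1\le i\le N-1$) be $\mathbf z=(z_1,\dots,z_N)$ with $z_i,z_{i+1}$ exchanged, and $s_N\mathbf z=(z_1,\dots,z_{N-1},z_N^{-1})$.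 Let $D\subset (k\setminus\{0\})^N$ be stable under $s_1,\dots,s_N$, with $z_i\ne z_{i+1}$ ($1\le i\le N-1$) and $z_N^2\ne1$ on $D$. For functions $f$ on $D$ and $(s_if)(\mathbf z)=f(s_i\mathbf z)$ set $$\hat T_i=-q-q^{-1}\frac{1-q^2z_iz_{i+1}^{-1}}{1-z_iz_{i+1}^{-1}}(s_i-1)\quad(1\le i\le N-1),$$ $$\hat T_N=-q_N-q_N^{-1}\frac{(1+q_N\zeta_Nz_N)(1-q_N\zeta_N^{-1}z_N)}{1-z_N^2}(s_N-1),$$ and $\hat e_i=\hat T_i-q_i^{-1}$ for $1\le i\le N$. Let $\Psi=\sum_b\Psi_b(\mathbf z)C_b$ be a function on $D$ with values in $V^{\otimes N}$; $e_i$ acts on the vectors $C_b$ and $\hat e_i$ on the components $\Psi_b$. Put $\Psi_0=\Psi_{-\cdots-}$. \textbf{Lemma.} The non-affine part of the boundary quantum Knizhnik--Zamolodchikov equation, $$e_i\Psi=\hat e_i\Psi\quad\text{for all }1\le i\le N,$$ is equivalent to the following three families of equations together: \begin{enumerate} \item for $1\le i\le N-1$ and every $\alpha$ with $(\alpha_i,\alpha_{i+1})=(-,+)$,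 with $s_i\alpha$ obtained from $\alpha$ by exchanging these two letters, $$(\hat e_i+q+q^{-1})\Psi_\alpha=\Psi_{s_i\alpha}+\sum_{\beta>\alpha,\ \beta_i\ge\beta_{i+1}}c^i_{\alpha\beta}\Psi_\beta;$$ \item for every $\alpha$ with $\alpha_N=-$, with $s_N\alpha$ obtained from $\alpha$ by changing the last letter, $$(\hat e_N+q_N+q_N^{-1})\Psi_\alpha=\kappa_N^{-1}\Psi_{s_N\alpha}+\sum_{\beta>\alpha,\ \beta_N=+}c^N_{\alpha\beta}\Psi_\beta;$$ \item $\hat e_i\Psi_0=0$ for $1\le i\le N-1$. \end{enumerate} Moreover (1), (2) and (3) imply all the trivial equations: $\hat e_i\Psi_\alpha=0$ whenever $1\le i\le N-1$ and $\alpha_i\ge\alpha_{i+1}$, and $\hat e_N\Psi_\alpha=0$ whenever $\alpha_N=+$. -/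

import Mathlib

noncomputable section

namespace BoundaryQKZ

/-! ### Binary strings

A binary string of length `N = n + 1` is a function `Fin (n + 1) → Bool`, where `true` is the letter
`+` and `false` is the letter `-`.  Thus `- < +` as letters.  Sites are numbered from `0` to `n`. -/

/-- Binary strings of length `N = n + 1`. -/
abbrev Str (n : ℕ) : Type := Fin (n + 1) → Bool

/-- The string `(+ ⋯ +)`. -/
def plusStr (n : ℕ) : Str n := fun _ => true

/-- The string `(- ⋯ -)`. -/
def minusStr (n : ℕ) : Str n := fun _ => false

/-- Strict lexicographic order on strings: `α` comes before `β` in the lexicographically ordered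
basis, in which `v_+` precedes `v_-`.  So `(+ ⋯ +)` is smallest and `(- ⋯ -)` is largest. -/
def LexLT {n : ℕ} (α β : Str n) : Prop :=
  ∃ i, (∀ j, j < i → α j = β j) ∧ α i = true ∧ β i = false

instance {n : ℕ} (α β : Str n) : Decidable (LexLT α β) :=
  inferInstanceAs (Decidable (∃ i, (∀ j, j < i → α j = β j) ∧ α i = true ∧ β i = false))

/-- Exchange of two neighbouring letters. -/
def swapStr {n : ℕ} (i : Fin n) (α : Str n) : Str n := α ∘ Equiv.swap i.castSucc i.succ

/-- Flip of the last letter. -/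
def flipStr {n : ℕ} (α : Str n) : Str n :=
  Function.update α (Fin.last n) (!(α (Fin.last n)))

/-! ### The generators of the one-boundary Temperley-Lieb algebra on `V^{⊗ N}`

`V^{⊗ N}` over a commutative ring `R` is `Str n → R`, with the basis `v_ε = Pi.single ε 1`.
Operators are matrices acting on column vectors: the entry at `(a, b)` is the coefficient of `v_a`
in the image of `v_b`. -/

section Generators

variable {R : Type*} [CommRing R]

/-- The `4 × 4` block of a bulk generator: on `(v_{+-}, v_{-+})` it is `[[-q⁻¹, 1], [1, -q]]`, and
it vanishes on `v_{++}` and `v_{--}`. -/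
def bulkBlock (q : Rˣ) : Matrix (Bool × Bool) (Bool × Bool) R :=
  Matrix.of fun a b =>
    if a.1 = a.2 ∨ b.1 = b.2 then 0
    else if a ≠ b then 1
    else if a.1 = true then -(↑q⁻¹ : R) else -(q : R)

/-- The `2 × 2` block `[[-q_N⁻¹, κ_N], [κ_N⁻¹, -q_N]]` of the boundary generator in the ordered basis
`(v_+, v_-)`. -/
def bdryBlock (qN κ : Rˣ) : Matrix Bool Bool R :=
  Matrix.of fun a b =>
    if a = true then (if b = true then -(↑qN⁻¹ : R) else (κ : R))
    else (if b = true then (↑κ⁻¹ : R) else -(qN : R))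

/-- The bulk generator acting on two neighbouring tensor factors. -/
def eBulk {n : ℕ} (q : Rˣ) (i : Fin n) : Matrix (Str n) (Str n) R :=
  Matrix.of fun α β =>
    if ∀ j, j ≠ i.castSucc → j ≠ i.succ → α j = β j then
      bulkBlock q (α i.castSucc, α i.succ) (β i.castSucc, β i.succ)
    else 0

/-- The boundary generator `e_N` acting on the last tensor factor. -/
def eBdry (n : ℕ) (qN κ : Rˣ) : Matrix (Str n) (Str n) R :=
  Matrix.of fun α β =>
    if ∀ j, j ≠ Fin.last n → α j = β j then
      bdryBlock qN κ (α (Fin.last n)) (β (Fin.last n))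
    else 0

/-- `T_i = e_i + q⁻¹` in the bulk. -/
def tBulk {n : ℕ} (q : Rˣ) (i : Fin n) : Matrix (Str n) (Str n) R :=
  eBulk q i + (↑q⁻¹ : R) • (1 : Matrix (Str n) (Str n) R)

/-- `T_N = e_N + q_N⁻¹`. -/
def tBdry (n : ℕ) (qN κ : Rˣ) : Matrix (Str n) (Str n) R :=
  eBdry n qN κ + (↑qN⁻¹ : R) • (1 : Matrix (Str n) (Str n) R)

end Generators

/-! ### Kazhdan-Lusztig bases -/

/-- Integral Laurent polynomials in `q, q_N, κ_N`; the exponent `(i, j, l)` stands for the monomial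
`q^i q_N^j κ_N^l`. -/
abbrev ParamRing : Type := AddMonoidAlgebra ℤ (ℤ × ℤ × ℤ)

/-- A monomial, as a unit. -/
def monomialUnit (g : ℤ × ℤ × ℤ) : ParamRingˣ :=
  Units.map (AddMonoidAlgebra.of ℤ (ℤ × ℤ × ℤ)) (toUnits (Multiplicative.ofAdd g))

/-- The bar involution of scalars: `q ↦ q⁻¹`, `q_N ↦ q_N⁻¹`, `κ_N ↦ κ_N`. -/
def scalarBar : ParamRing →+* ParamRing :=
  AddMonoidAlgebra.mapDomainRingHom ℤ
    (AddMonoidHom.prodMap (negAddMonoidHom : ℤ →+ ℤ)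
      (AddMonoidHom.prodMap (negAddMonoidHom : ℤ →+ ℤ) (AddMonoidHom.id ℤ)))

/-- The three types of Kazhdan-Lusztig bases; type BI carries the integer `M ≥ 1` with
`q_N = q^M`. -/
inductive KLType : Type
  | BI (M : ℕ+)
  | BII
  | BIII

/-- The unit `q`. -/
def qUnit : ParamRingˣ := monomialUnit (1, 0, 0)

/-- The unit `κ_N`. -/
def κUnit : ParamRingˣ := monomialUnit (0, 0, 1)

/-- The boundary parameter: `q^M` for type BI (where the second variable of `ParamRing` plays no
role), and the independent variable `q_N` for types BII and BIII. -/
def KLType.qNUnit : KLType → ParamRingˣ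
  | .BI M => qUnit ^ (M : ℕ)
  | .BII => monomialUnit (0, 1, 0)
  | .BIII => monomialUnit (0, 1, 0)

/-- The negative monomials `A_-`: powers of `κ_N` are nonnegative, and the rest is negative, with
`q` dominating `q_N` for type BII and `q_N` dominating `q` for type BIII. -/
def KLType.negMonomials : KLType → Set (ℤ × ℤ × ℤ)
  | .BI _ => {g | g.1 < 0 ∧ g.2.1 = 0 ∧ 0 ≤ g.2.2}
  | .BII => {g | (g.1 < 0 ∨ (g.1 = 0 ∧ g.2.1 < 0)) ∧ 0 ≤ g.2.2}
  | .BIII => {g | (g.2.1 < 0 ∨ (g.2.1 = 0 ∧ g.1 < 0)) ∧ 0 ≤ g.2.2}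

/-- The bar involution of `V^{⊗ N}`: additive, semilinear for the bar involution of scalars, fixing
`v_{+ ⋯ +}`, and compatible with `T_i ↦ T_i⁻¹` for all non-affine generators.  The last property,
`bar (T_i v) = T_i⁻¹ (bar v)`, is written without the inverse. -/
structure IsBar (n : ℕ) (X : KLType) (bar : (Str n → ParamRing) → (Str n → ParamRing)) : Prop where
  map_add : ∀ v w, bar (v + w) = bar v + bar w
  map_smul : ∀ (r : ParamRing) v, bar (r • v) = scalarBar r • bar v
  map_plus : bar (Pi.single (plusStr n) 1) = Pi.single (plusStr n) 1
  map_bulk : ∀ (i : Fin n) v,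
    (tBulk qUnit i).mulVec (bar ((tBulk qUnit i).mulVec v)) = bar v
  map_bdry : ∀ v,
    (tBdry n X.qNUnit κUnit).mulVec (bar ((tBdry n X.qNUnit κUnit).mulVec v)) = bar v

/-- `C` is the Kazhdan-Lusztig basis of type `X`: each `C ε` is bar invariant, and
`C ε = v_ε + ∑_{ε' < ε} (element of the ℤ-span of A_-) v_ε'`.  Here `C ε ε'` is the coefficient
of `v_ε'` in `C ε`. -/
structure IsKLBasis (n : ℕ) (X : KLType) (C : Str n → Str n → ParamRing) : Prop where
  bar_invariant : ∃ bar, IsBar n X bar ∧ ∀ ε, bar (C ε) = C ε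
  diag : ∀ ε, C ε ε = 1
  lower : ∀ ε ε', LexLT ε' ε → ∀ g, (C ε ε').coeff g ≠ 0 → g ∈ X.negMonomials
  upper : ∀ ε ε', LexLT ε ε' → C ε ε' = 0

/-! ### Values of the parameters -/

section Field

variable {k : Type*} [Field k]

/-- Evaluation of Laurent polynomials in the parameters at nonzero scalars. -/
def specialize (q qN κ : kˣ) : ParamRing →+* k :=
  (AddMonoidAlgebra.lift ℤ k (ℤ × ℤ × ℤ)
    { toFun := fun g =>
        ((q ^ g.toAdd.1 * qN ^ g.toAdd.2.1 * κ ^ g.toAdd.2.2 : kˣ) : k)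
      map_one' := by simp
      map_mul' := fun a b => by
        simp only [toAdd_mul, Prod.fst_add, Prod.snd_add, zpow_add, Units.val_mul]
        ring }).toRingHom

/-- The Kazhdan-Lusztig vector `C_ε` in `V^{⊗ N}` over `k`. -/
def klVec {n : ℕ} (q qN κ : kˣ) (C : Str n → Str n → ParamRing) (ε : Str n) : Str n → k :=
  fun ε' => specialize q qN κ (C ε ε')

/-- The transition matrix whose columns are the vectors `C_ε`. -/
def klMatrix {n : ℕ} (q qN κ : kˣ) (C : Str n → Str n → ParamRing) : Matrix (Str n) (Str n) k :=
  Matrix.of fun ε' ε => klVec q qN κ C ε ε'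

/-- The entry at `(α, β)` is the coefficient of `C_α` in the expansion of `E C_β`. -/
def klCoeff {n : ℕ} (q qN κ : kˣ) (C : Str n → Str n → ParamRing) (E : Matrix (Str n) (Str n) k) :
    Matrix (Str n) (Str n) k :=
  (klMatrix q qN κ C)⁻¹ * E * klMatrix q qN κ C

/-! ### The operators on functions of `z` -/

/-- `s_i z`: exchange of two neighbouring coordinates. -/
def swapPt {n : ℕ} (i : Fin n) (z : Fin (n + 1) → k) : Fin (n + 1) → k :=
  z ∘ Equiv.swap i.castSucc i.succ

/-- `s_N z`: inversion of the last coordinate. -/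
def invPt {n : ℕ} (z : Fin (n + 1) → k) : Fin (n + 1) → k :=
  Function.update z (Fin.last n) (z (Fin.last n))⁻¹

/-- A domain for functions of `z`: a subset of `(k \ {0})^N` which is stable under the finite Weyl
group generated by `s_1, …, s_N` and on which the denominators of the operators do not vanish. -/
structure IsWeylDomain {n : ℕ} (D : Set (Fin (n + 1) → k)) : Prop where
  ne_zero : ∀ z ∈ D, ∀ i, z i ≠ 0
  ne_adjacent : ∀ z ∈ D, ∀ i : Fin n, z i.castSucc ≠ z i.succ
  last_sq_ne_one : ∀ z ∈ D, z (Fin.last n) ^ 2 ≠ 1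
  swap_mem : ∀ z ∈ D, ∀ i : Fin n, swapPt i z ∈ D
  inv_mem : ∀ z ∈ D, invPt z ∈ D

/-- The operator `T̂_i` in the bulk. -/
def tHatBulk {n : ℕ} (q : kˣ) (i : Fin n) (f : (Fin (n + 1) → k) → k) (z : Fin (n + 1) → k) : k :=
  -(q : k) * f z
    - (q : k)⁻¹ * ((1 - (q : k) ^ 2 * z i.castSucc * (z i.succ)⁻¹)
        / (1 - z i.castSucc * (z i.succ)⁻¹)) * (f (swapPt i z) - f z)

/-- The operator `T̂_N`. -/
def tHatBdry {n : ℕ} (qN ζ : kˣ) (f : (Fin (n + 1) → k) → k) (z : Fin (n + 1) → k) : k :=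
  -(qN : k) * f z
    - (qN : k)⁻¹ * (((1 + (qN : k) * ζ * z (Fin.last n)) * (1 - (qN : k) * (ζ : k)⁻¹ * z (Fin.last n)))
        / (1 - z (Fin.last n) ^ 2)) * (f (invPt z) - f z)

/-- `ê_i = T̂_i - q⁻¹` in the bulk. -/
def eHatBulk {n : ℕ} (q : kˣ) (i : Fin n) (f : (Fin (n + 1) → k) → k) (z : Fin (n + 1) → k) : k :=
  tHatBulk q i f z - (q : k)⁻¹ * f z

/-- `ê_N = T̂_N - q_N⁻¹`. -/
def eHatBdry {n : ℕ} (qN ζ : kˣ) (f : (Fin (n + 1) → k) → k) (z : Fin (n + 1) → k) : k :=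
  tHatBdry qN ζ f z - (qN : k)⁻¹ * f z

/-! ### The systems of equations

`Ψ b` is the component of the vector-valued function along `C_b`. -/

/-- The non-affine part `e_i Ψ = ê_i Ψ`, `1 ≤ i ≤ N`, as an identity in `V^{⊗ N}`, where
`Ψ(z) = ∑_b Ψ_b(z) C_b`, `e_i` acts on the vectors and `ê_i` on the component functions. -/
def NonAffinePart {n : ℕ} (q qN κ ζ : kˣ) (C : Str n → Str n → ParamRing)
    (D : Set (Fin (n + 1) → k)) (Ψ : Str n → (Fin (n + 1) → k) → k) : Prop :=
  (∀ i : Fin n, ∀ z ∈ D,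
    (eBulk q i).mulVec (∑ b, Ψ b z • klVec q qN κ C b)
      = ∑ b, eHatBulk q i (Ψ b) z • klVec q qN κ C b) ∧
  (∀ z ∈ D,
    (eBdry n qN κ).mulVec (∑ b, Ψ b z • klVec q qN κ C b)
      = ∑ b, eHatBdry qN ζ (Ψ b) z • klVec q qN κ C b)

/-- The non-trivial bulk equations, for `(α_i, α_{i+1}) = (-, +)`:
`(ê_i + q + q⁻¹) Ψ_α = Ψ_{s_i α} + ∑_{β > α, β_i ≥ β_{i+1}} c^i_{αβ} Ψ_β`. -/
def NontrivialBulk {n : ℕ} (q qN κ : kˣ) (C : Str n → Str n → ParamRing)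
    (D : Set (Fin (n + 1) → k)) (Ψ : Str n → (Fin (n + 1) → k) → k) : Prop :=
  ∀ (i : Fin n) (α : Str n), α i.castSucc = false → α i.succ = true → ∀ z ∈ D,
    eHatBulk q i (Ψ α) z + ((q : k) + (q : k)⁻¹) * Ψ α z
      = Ψ (swapStr i α) z
        + ∑ β with LexLT α β ∧ β i.succ ≤ β i.castSucc,
            klCoeff q qN κ C (eBulk q i) α β * Ψ β z

/-- The non-trivial boundary equations, for `α_N = -`:
`(ê_N + q_N + q_N⁻¹) Ψ_α = κ_N⁻¹ Ψ_{s_N α} + ∑_{β > α, β_N = +} c^N_{αβ} Ψ_β`. -/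
def NontrivialBdry {n : ℕ} (q qN κ ζ : kˣ) (C : Str n → Str n → ParamRing)
    (D : Set (Fin (n + 1) → k)) (Ψ : Str n → (Fin (n + 1) → k) → k) : Prop :=
  ∀ α : Str n, α (Fin.last n) = false → ∀ z ∈ D,
    eHatBdry qN ζ (Ψ α) z + ((qN : k) + (qN : k)⁻¹) * Ψ α z
      = (κ : k)⁻¹ * Ψ (flipStr α) z
        + ∑ β with LexLT α β ∧ β (Fin.last n) = true,
            klCoeff q qN κ C (eBdry n qN κ) α β * Ψ β z

/-- The equations `ê_i Ψ_0 = 0`, `1 ≤ i ≤ N - 1`, for the component `Ψ_0` along `C_{- ⋯ -}`. -/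
def ZeroEquations {n : ℕ} (q : kˣ)
    (D : Set (Fin (n + 1) → k)) (Ψ : Str n → (Fin (n + 1) → k) → k) : Prop :=
  ∀ i : Fin n, ∀ z ∈ D, eHatBulk q i (Ψ (minusStr n)) z = 0

/-- All the trivial equations: `ê_i Ψ_α = 0` if `α_i ≥ α_{i+1}`, and `ê_N Ψ_α = 0` if `α_N = +`. -/
def TrivialEquations {n : ℕ} (q qN ζ : kˣ)
    (D : Set (Fin (n + 1) → k)) (Ψ : Str n → (Fin (n + 1) → k) → k) : Prop :=
  (∀ (i : Fin n) (α : Str n), α i.succ ≤ α i.castSucc → ∀ z ∈ D, eHatBulk q i (Ψ α) z = 0) ∧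
  (∀ α : Str n, α (Fin.last n) = true → ∀ z ∈ D, eHatBdry qN ζ (Ψ α) z = 0)

end Field

end BoundaryQKZ

end

/-! Along the basis `C`, the `α`-component of `e_i Ψ = ê_i Ψ` reads `ê_i Ψ_α = ∑_β c^i_{αβ} Ψ_β`.
Call `α` a descent for `i` if `(α_i, α_{i+1}) = (-, +)`, respectively `α_N = -`. Three facts
determine the shape of `c^i` (`IsKLBasis.klCoeff_gen`): rows outside the descents vanish; `C_β` with
`β` a descent is an eigenvector for `-(q_i + q_i⁻¹)`; the only nonzero entries with `α > β` sit at
`α = s_i β` and equal `1` or `κ_N⁻¹`. Hence the components at descents are exactly (1) and (2), and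
all others are the trivial equations. This gives the forward implication.

The three facts rest on the uniqueness principle for Kazhdan-Lusztig bases: a bar invariant scalar
in the span of `A_-` is zero. The image of `e_i` is cut out by explicit linear relations
(`InImage`), and `IsKLBasis.inImage_of_isDes` shows that `C_α` satisfies them when `α` is a descent.

The converse is a downward lexicographic induction (`IsCellular.intertwines`). A string `α` other
than `(- ⋯ -)` has an ascent `j`, and the descent equation for `j` at `s_j α` expresses `Ψ_α`
through `ê_j Ψ_{s_j α}` and components above `α`. Applying `ê_i` leads to words in the `ê`'s acting
on larger components. These are rewritten by the quadratic, commutation and braid relations, which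
hold both for the matrices `c^i` (as `e_i` satisfies the one-boundary Temperley-Lieb relations) and
for the `ê_i` (by computation with rational functions). Family (3) starts the induction, since `(- ⋯
-)` has no ascent. -/

noncomputable section

namespace BoundaryQKZ

/-! ### Strings -/

namespace LexLT

variable {n : ℕ} {α β γ : Str n}

theorem irrefl (α : Str n) : ¬ LexLT α α := by
  rintro ⟨i, -, h1, h2⟩
  simp [h1] at h2

theorem trans (h : LexLT α β) (h' : LexLT β γ) : LexLT α γ := by
  obtain ⟨i, hi, hi1, hi2⟩ := h
  obtain ⟨j, hj, hj1, hj2⟩ := h'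
  rcases lt_trichotomy i j with hij | rfl | hij
  · exact ⟨i, fun m hm => (hi m hm).trans (hj m (hm.trans hij)), hi1, (hj i hij) ▸ hi2⟩
  · simp [hi2] at hj1
  · exact ⟨j, fun m hm => (hi m (hm.trans hij)).trans (hj m hm), (hi j hij).trans hj1, hj2⟩

theorem asymm (h : LexLT α β) : ¬ LexLT β α := fun h' => irrefl _ (h.trans h')

theorem ne (h : LexLT α β) : α ≠ β := by
  rintro rfl
  exact irrefl _ h

/-- The first place where two different strings differ. -/
theorem exists_first_ne (h : α ≠ β) : ∃ i, (∀ j, j < i → α j = β j) ∧ α i ≠ β i := by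
  obtain ⟨i, hi⟩ := Function.ne_iff.mp h
  obtain ⟨m, hm, hmin⟩ := wellFounded_lt.has_min {i | α i ≠ β i} ⟨i, hi⟩
  exact ⟨m, fun j hj => by_contra fun hne => hmin j hne hj, hm⟩

theorem trichotomous (α β : Str n) : LexLT α β ∨ α = β ∨ LexLT β α := by
  by_cases h : α = β
  · exact Or.inr (Or.inl h)
  obtain ⟨i, hi, hne⟩ := exists_first_ne h
  cases ha : α i <;> cases hb : β i
  · simp [ha, hb] at hne
  · exact Or.inr (Or.inr ⟨i, fun j hj => (hi j hj).symm, hb, ha⟩)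
  · exact Or.inl ⟨i, hi, ha, hb⟩
  · simp [ha, hb] at hne

instance : IsTrans (Str n) LexLT := ⟨fun _ _ _ => trans⟩
instance : Std.Irrefl (LexLT (n := n)) := ⟨irrefl⟩

theorem wellFounded : WellFounded (LexLT (n := n)) :=
  Finite.wellFounded_of_trans_of_irrefl _

theorem wellFounded_swap : WellFounded (Function.swap (LexLT (n := n))) :=
  haveI : IsTrans (Str n) (Function.swap LexLT) := ⟨fun _ _ _ h h' => trans h' h⟩
  haveI : Std.Irrefl (Function.swap (LexLT (n := n))) := ⟨irrefl⟩
  Finite.wellFounded_of_trans_of_irrefl _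

end LexLT

/-! ### Reflections, descents and ascents of strings -/

section Reflections

variable {n : ℕ}

/-- The action of the finite Weyl group generators on strings; `none` is the boundary generator. -/
def refl : Option (Fin n) → Str n → Str n
  | some i, α => swapStr i α
  | none, α => flipStr α

/-- `α` is a descent: it is larger than its reflection. -/
def IsDes : Option (Fin n) → Str n → Prop
  | some i, α => α i.castSucc = false ∧ α i.succ = true
  | none, α => α (Fin.last n) = false

/-- `α` is an ascent: it is smaller than its reflection. -/
def IsAsc : Option (Fin n) → Str n → Prop
  | some i, α => α i.castSucc = true ∧ α i.succ = false
  | none, α => α (Fin.last n) = true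

instance (i : Option (Fin n)) (α : Str n) : Decidable (IsDes i α) := by
  cases i <;> unfold IsDes <;> infer_instance

instance (i : Option (Fin n)) (α : Str n) : Decidable (IsAsc i α) := by
  cases i <;> unfold IsAsc <;> infer_instance

@[simp] theorem swapStr_castSucc (i : Fin n) (α : Str n) : swapStr i α i.castSucc = α i.succ := by
  simp [swapStr]

@[simp] theorem swapStr_succ (i : Fin n) (α : Str n) : swapStr i α i.succ = α i.castSucc := by
  simp [swapStr]

theorem swapStr_of_ne (i : Fin n) (α : Str n) {j : Fin (n + 1)} (h : j ≠ i.castSucc)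
    (h' : j ≠ i.succ) : swapStr i α j = α j := by
  simp [swapStr, Equiv.swap_apply_of_ne_of_ne h h']

@[simp] theorem flipStr_last (α : Str n) : flipStr α (Fin.last n) = !(α (Fin.last n)) := by
  simp [flipStr]

theorem flipStr_of_ne (α : Str n) {j : Fin (n + 1)} (h : j ≠ Fin.last n) : flipStr α j = α j := by
  simp [flipStr, Function.update_of_ne h]

@[simp] theorem refl_refl (i : Option (Fin n)) (α : Str n) : refl i (refl i α) = α := by
  cases i with
  | none =>
    funext j
    by_cases h : j = Fin.last n
    · subst h; simp [refl]
    · simp [refl, flipStr_of_ne _ h]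
  | some i => funext j; simp [refl, swapStr]

@[simp] theorem isDes_refl (i : Option (Fin n)) (α : Str n) : IsDes i (refl i α) ↔ IsAsc i α := by
  cases i <;> simp [IsDes, IsAsc, refl, and_comm]

@[simp] theorem isAsc_refl (i : Option (Fin n)) (α : Str n) : IsAsc i (refl i α) ↔ IsDes i α := by
  cases i <;> simp [IsDes, IsAsc, refl, and_comm]

theorem IsAsc.not_isDes {i : Option (Fin n)} {α : Str n} (h : IsAsc i α) : ¬ IsDes i α := by
  cases i with
  | none => simp_all [IsDes, IsAsc]
  | some i => simp_all [IsDes, IsAsc]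

theorem IsDes.lexLT {i : Option (Fin n)} {α : Str n} (h : IsDes i α) : LexLT (refl i α) α := by
  cases i with
  | none =>
    refine ⟨Fin.last n, fun j hj => flipStr_of_ne _ hj.ne, ?_, h⟩
    simpa [refl, IsDes] using h
  | some i =>
    refine ⟨i.castSucc, fun j hj => swapStr_of_ne _ _ hj.ne (hj.trans i.castSucc_lt_succ).ne,
      ?_, h.1⟩
    simpa [refl] using h.2

theorem IsAsc.lexLT {i : Option (Fin n)} {α : Str n} (h : IsAsc i α) : LexLT α (refl i α) := by
  simpa using ((isDes_refl i α).mpr h).lexLT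

end Reflections

/-! ### The generators -/

section Generators

variable {R : Type*} [CommRing R] {n : ℕ}

/-- All generators; `none` is the boundary generator. -/
def gen (q qN κ : Rˣ) : Option (Fin n) → Matrix (Str n) (Str n) R
  | some i => eBulk q i
  | none => eBdry n qN κ

/-- The Hecke parameters. -/
def heckePar (q qN : Rˣ) : Option (Fin n) → Rˣ
  | some _ => q
  | none => qN

/-- The off-diagonal weights. -/
def weight (κ : Rˣ) : Option (Fin n) → Rˣ
  | some _ => 1
  | none => κ

/-- Bulk and boundary generators have the same shape once rows are sorted by descent and ascent.
From here on both are treated at once, with `heckePar` and `weight` carrying the difference. -/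
theorem gen_apply (q qN κ : Rˣ) (i : Option (Fin n)) (α β : Str n) :
    gen q qN κ i α β =
      if IsDes i α then
        (if β = refl i α then (↑(weight κ i)⁻¹ : R) else 0)
          - (if β = α then (heckePar q qN i : R) else 0)
      else if IsAsc i α then
        (if β = refl i α then (weight κ i : R) else 0)
          - (if β = α then (↑(heckePar q qN i)⁻¹ : R) else 0)
      else 0 := by
  cases i with
  | none =>
    have h1 : (β = α) ↔ (∀ j, j ≠ Fin.last n → α j = β j) ∧ α (Fin.last n) = β (Fin.last n) := by
      constructor
      · rintro rfl; simp
      · rintro ⟨h, h'⟩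
        funext j
        by_cases hj : j = Fin.last n
        · subst hj; exact h'.symm
        · exact (h j hj).symm
    have h2 : (β = refl none α) ↔
        (∀ j, j ≠ Fin.last n → α j = β j) ∧ (!α (Fin.last n)) = β (Fin.last n) := by
      constructor
      · rintro rfl
        exact ⟨fun j hj => (flipStr_of_ne _ hj).symm, by simp [refl]⟩
      · rintro ⟨h, h'⟩
        funext j
        by_cases hj : j = Fin.last n
        · subst hj; simp [refl, h']
        · simp [refl, flipStr_of_ne _ hj, h j hj]
    simp only [h1, h2, gen, eBdry, Matrix.of_apply, bdryBlock, IsDes, IsAsc, weight, heckePar]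
    cases α (Fin.last n) <;> cases β (Fin.last n) <;> simp <;> split_ifs <;> simp
  | some i =>
    have h1 : (β = α) ↔ (∀ j, j ≠ i.castSucc → j ≠ i.succ → α j = β j) ∧
        α i.castSucc = β i.castSucc ∧ α i.succ = β i.succ := by
      constructor
      · rintro rfl; simp
      · rintro ⟨h, h', h''⟩
        funext j
        by_cases hj : j = i.castSucc
        · subst hj; exact h'.symm
        by_cases hj' : j = i.succ
        · subst hj'; exact h''.symm
        · exact (h j hj hj').symm
    have h2 : (β = refl (some i) α) ↔ (∀ j, j ≠ i.castSucc → j ≠ i.succ → α j = β j) ∧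
        α i.castSucc = β i.succ ∧ α i.succ = β i.castSucc := by
      constructor
      · rintro rfl
        exact ⟨fun j hj hj' => (swapStr_of_ne _ _ hj hj').symm, by simp [refl], by simp [refl]⟩
      · rintro ⟨h, h', h''⟩
        funext j
        by_cases hj : j = i.castSucc
        · subst hj; simp [refl, h'']
        by_cases hj' : j = i.succ
        · subst hj'; simp [refl, h']
        · simp [refl, swapStr_of_ne _ _ hj hj', h j hj hj']
    simp only [h1, h2, gen, eBulk, Matrix.of_apply, bulkBlock, IsDes, IsAsc, weight, heckePar]
    cases α i.castSucc <;> cases β i.castSucc <;> cases α i.succ <;> cases β i.succ <;>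
      simp <;> split_ifs <;> simp

theorem gen_mulVec (q qN κ : Rˣ) (i : Option (Fin n)) (v : Str n → R) (α : Str n) :
    (gen q qN κ i).mulVec v α =
      if IsDes i α then ↑(weight κ i)⁻¹ * v (refl i α) - heckePar q qN i * v α
      else if IsAsc i α then weight κ i * v (refl i α) - ↑(heckePar q qN i)⁻¹ * v α
      else 0 := by
  simp only [Matrix.mulVec, dotProduct, gen_apply]
  split_ifs <;> simp [sub_mul, Finset.sum_sub_distrib]

variable (q qN κ : Rˣ) {i : Option (Fin n)} (v : Str n → R) {α : Str n}

theorem gen_mulVec_of_isDes (h : IsDes i α) : (gen q qN κ i).mulVec v α =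
    ↑(weight κ i)⁻¹ * v (refl i α) - heckePar q qN i * v α := by
  rw [gen_mulVec, if_pos h]

theorem gen_mulVec_of_isAsc (h : IsAsc i α) : (gen q qN κ i).mulVec v α =
    weight κ i * v (refl i α) - ↑(heckePar q qN i)⁻¹ * v α := by
  rw [gen_mulVec, if_neg h.not_isDes, if_pos h]

theorem gen_mulVec_of_not (h : ¬ IsDes i α) (h' : ¬ IsAsc i α) :
    (gen q qN κ i).mulVec v α = 0 := by
  rw [gen_mulVec, if_neg h, if_neg h']

/-- The relations which characterize the image of a generator. -/
def InImage (q qN κ : Rˣ) (i : Option (Fin n)) (v : Str n → R) : Prop :=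
  ∀ α, ¬ IsDes i α →
    v α + (if IsAsc i α then ↑(weight κ i) * ↑(heckePar q qN i)⁻¹ * v (refl i α) else 0) = 0

theorem inImage_gen_mulVec (i : Option (Fin n)) (v : Str n → R) :
    InImage q qN κ i ((gen q qN κ i).mulVec v) := by
  intro α hα
  split_ifs with h
  · rw [gen_mulVec_of_isAsc _ _ _ _ h, gen_mulVec_of_isDes _ _ _ _ ((isDes_refl i α).mpr h),
      refl_refl]
    have h1 := (weight κ i).mul_inv
    have h2 := (heckePar q qN i).inv_mul
    linear_combination (↑(heckePar q qN i)⁻¹ * v α) * h1 - (weight κ i : R) * v (refl i α) * h2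
  · rw [gen_mulVec_of_not _ _ _ _ hα h, add_zero]

/-- Each two-dimensional block of `e_i` has rank one and trace `-(p + p⁻¹)`, with `p` the Hecke
parameter, so `e_i` acts on its image by that scalar. -/
theorem InImage.gen_mulVec_eq {i : Option (Fin n)} {v : Str n → R} (h : InImage q qN κ i v) :
    (gen q qN κ i).mulVec v =
      (-((heckePar q qN i : R) + (↑(heckePar q qN i)⁻¹ : R))) • v := by
  funext α
  have h1 := (weight κ i).inv_mul
  have h2 := (heckePar q qN i).mul_inv
  simp only [Pi.smul_apply, smul_eq_mul]
  by_cases hd : IsDes i α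
  · have h0 := h (refl i α) (by
      rw [isDes_refl]; intro ha; exact ha.not_isDes hd)
    rw [if_pos ((isAsc_refl i α).mpr hd), refl_refl] at h0
    rw [gen_mulVec_of_isDes _ _ _ _ hd]
    linear_combination (↑(weight κ i)⁻¹ : R) * h0 - (↑(heckePar q qN i)⁻¹ : R) * v α * h1
  · have h0 := h α hd
    by_cases ha : IsAsc i α
    · rw [if_pos ha] at h0
      rw [gen_mulVec_of_isAsc _ _ _ _ ha]
      linear_combination (heckePar q qN i : R) * h0 - (weight κ i : R) * v (refl i α) * h2
    · rw [if_neg ha, add_zero] at h0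
      rw [gen_mulVec_of_not _ _ _ _ hd ha, h0, mul_zero]

theorem gen_mul_gen (i : Option (Fin n)) : gen q qN κ i * gen q qN κ i =
    (-((heckePar q qN i : R) + (↑(heckePar q qN i)⁻¹ : R))) • gen q qN κ i := by
  refine Matrix.mulVec_injective (funext fun v => ?_)
  rw [← Matrix.mulVec_mulVec, (inImage_gen_mulVec q qN κ i v).gen_mulVec_eq, Matrix.smul_mulVec]

end Generators

/-! ### Generators acting on disjoint sites -/

section Far

variable {n : ℕ}

/-- The sites on which a generator acts. -/
def IsSite : Option (Fin n) → Fin (n + 1) → Prop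
  | some i, m => m = i.castSucc ∨ m = i.succ
  | none, m => m = Fin.last n

/-- Two generators act on disjoint sets of sites. -/
def Far (i j : Option (Fin n)) : Prop := ∀ m, IsSite i m → ¬ IsSite j m

theorem Far.symm {i j : Option (Fin n)} (h : Far i j) : Far j i := fun m hj hi => h m hi hj

theorem refl_of_not_isSite {i : Option (Fin n)} (α : Str n) {m : Fin (n + 1)} (h : ¬ IsSite i m) :
    refl i α m = α m := by
  cases i with
  | none => exact flipStr_of_ne _ h
  | some i => exact swapStr_of_ne _ _ (fun h' => h (Or.inl h')) (fun h' => h (Or.inr h'))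

theorem refl_congr {i : Option (Fin n)} {α β : Str n} (h : ∀ m, IsSite i m → α m = β m)
    {m : Fin (n + 1)} (hm : IsSite i m) : refl i α m = refl i β m := by
  cases i with
  | none =>
    obtain rfl : m = Fin.last n := hm
    simp [refl, h (Fin.last n) rfl]
  | some i =>
    rcases hm with rfl | rfl
    · simpa [refl] using h i.succ (Or.inr rfl)
    · simpa [refl] using h i.castSucc (Or.inl rfl)

theorem isDes_congr {i : Option (Fin n)} {α β : Str n} (h : ∀ m, IsSite i m → α m = β m) :
    IsDes i α ↔ IsDes i β := by
  cases i with
  | none => simp [IsDes, h (Fin.last n) rfl]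
  | some i => simp [IsDes, h i.castSucc (Or.inl rfl), h i.succ (Or.inr rfl)]

theorem isAsc_congr {i : Option (Fin n)} {α β : Str n} (h : ∀ m, IsSite i m → α m = β m) :
    IsAsc i α ↔ IsAsc i β := by
  cases i with
  | none => simp [IsAsc, h (Fin.last n) rfl]
  | some i => simp [IsAsc, h i.castSucc (Or.inl rfl), h i.succ (Or.inr rfl)]

variable {i j : Option (Fin n)}

theorem Far.isDes_refl (h : Far i j) (α : Str n) : IsDes i (refl j α) ↔ IsDes i α :=
  isDes_congr fun m hm => refl_of_not_isSite α (h m hm)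

theorem Far.isAsc_refl (h : Far i j) (α : Str n) : IsAsc i (refl j α) ↔ IsAsc i α :=
  isAsc_congr fun m hm => refl_of_not_isSite α (h m hm)

theorem Far.refl_comm (h : Far i j) (α : Str n) : refl i (refl j α) = refl j (refl i α) := by
  funext m
  by_cases hi : IsSite i m
  · rw [refl_of_not_isSite _ (h m hi)]
    exact refl_congr (fun m hm => refl_of_not_isSite α (h m hm)) hi
  · rw [refl_of_not_isSite _ hi]
    by_cases hj : IsSite j m
    · exact refl_congr (fun m hm => (refl_of_not_isSite α (h.symm m hm)).symm) hj
    · rw [refl_of_not_isSite _ hj, refl_of_not_isSite _ hj, refl_of_not_isSite _ hi]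

end Far

/-! ### One-boundary Temperley-Lieb relations -/

section Relations

variable {R : Type*} [CommRing R] {n : ℕ} (q qN κ : Rˣ)

theorem Far.gen_comm {i j : Option (Fin n)} (h : Far i j) :
    gen q qN κ i * gen q qN κ j = gen q qN κ j * gen q qN κ i := by
  refine Matrix.mulVec_injective (funext fun v => funext fun α => ?_)
  rw [← Matrix.mulVec_mulVec, ← Matrix.mulVec_mulVec]
  rw [gen_mulVec, gen_mulVec _ _ _ j ((gen q qN κ i).mulVec v)]
  simp only [gen_mulVec _ _ _ _ v, h.isDes_refl, h.isAsc_refl, h.symm.isDes_refl, h.symm.isAsc_refl,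
    h.refl_comm]
  split_ifs <;> ring

theorem InImage.eq_zero {i : Option (Fin n)} {v : Str n → R} (h : InImage q qN κ i v) {α : Str n}
    (h1 : ¬ IsDes i α) (h2 : ¬ IsAsc i α) : v α = 0 := by
  simpa [h2] using h α h1

theorem InImage.apply_of_isAsc {i : Option (Fin n)} {v : Str n → R} (h : InImage q qN κ i v)
    {α : Str n} (h2 : IsAsc i α) :
    v α = - (↑(weight κ i) * ↑(heckePar q qN i)⁻¹ * v (refl i α)) := by
  have := h α h2.not_isDes
  rw [if_pos h2] at this
  linear_combination this

theorem InImage.apply_refl_of_isAsc {i : Option (Fin n)} {v : Str n → R} (h : InImage q qN κ i v)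
    {α : Str n} (h2 : IsAsc i α) :
    v (refl i α) = - (↑(weight κ i)⁻¹ * ↑(heckePar q qN i) * v α) := by
  have h1 := (weight κ i).inv_mul
  have h3 := (heckePar q qN i).mul_inv
  have := h.apply_of_isAsc _ _ _ h2
  linear_combination (↑(weight κ i)⁻¹ * ↑(heckePar q qN i) : R) * this
    - v (refl i α) * h3 - v (refl i α) * h1 * (heckePar q qN i : R) * ↑(heckePar q qN i)⁻¹

theorem InImage.ext {i : Option (Fin n)} {v w : Str n → R} (hv : InImage q qN κ i v)
    (hw : InImage q qN κ i w) (h : ∀ α, IsAsc i α → v α = w α) : v = w := by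
  funext α
  by_cases ha : IsAsc i α
  · exact h α ha
  by_cases hd : IsDes i α
  · have ha' := (isAsc_refl i α).mpr hd
    have h1 := hv.apply_refl_of_isAsc _ _ _ ha'
    have h2 := hw.apply_refl_of_isAsc _ _ _ ha'
    rw [refl_refl] at h1 h2
    rw [h1, h2, h _ ha']
  · rw [hv.eq_zero _ _ _ hd ha, hw.eq_zero _ _ _ hd ha]

theorem InImage.smul {i : Option (Fin n)} {v : Str n → R} (hv : InImage q qN κ i v) (c : R) :
    InImage q qN κ i (c • v) := by
  intro α hα
  have := hv α hα
  split_ifs at this ⊢ <;> simp only [Pi.smul_apply, smul_eq_mul] <;> linear_combination c * this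

/-- A vector in the image of `e_i` is determined by its coordinates at ascents, so the relation has
to be tested only there, and only on vectors already in the image. -/
theorem gen_mul_gen_mul_gen_of_inImage {i j : Option (Fin n)} (c : R)
    (H : ∀ v : Str n → R, InImage q qN κ i v → ∀ α, IsAsc i α →
      (gen q qN κ i).mulVec ((gen q qN κ j).mulVec v) α = c * v α) :
    gen q qN κ i * gen q qN κ j * gen q qN κ i = c • gen q qN κ i := by
  refine Matrix.mulVec_injective (funext fun v => ?_)
  rw [← Matrix.mulVec_mulVec, ← Matrix.mulVec_mulVec, Matrix.smul_mulVec]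
  have h := inImage_gen_mulVec q qN κ i v
  exact (inImage_gen_mulVec q qN κ i _).ext _ _ _ (h.smul _ _ _ c) (H _ h)

/-- A vector in the image of `e_i` vanishes at strings with equal letters at the two sites of `i`.
At `(+, -, c)` every string created by `e_j` is of this kind, so only diagonal entries of `e_j`
contribute. -/
theorem gen_temperley_lieb_left {i j : Fin n} (hij : i.succ = j.castSucc) :
    gen q qN κ (some i) * gen q qN κ (some j) * gen q qN κ (some i) = gen q qN κ (some i) := by
  have := gen_mul_gen_mul_gen_of_inImage q qN κ (i := some i) (j := some j) 1 ?_
  · rwa [one_smul] at this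
  intro v hv α hα
  have h1 : j.succ ≠ i.castSucc := by
    simp only [Fin.ext_iff, Fin.val_succ, Fin.val_castSucc, ne_eq] at hij ⊢
    omega
  have h2 : j.succ ≠ i.succ := by rw [hij]; exact j.castSucc_lt_succ.ne'
  have h3 : i.castSucc ≠ j.castSucc := by rw [← hij]; exact i.castSucc_lt_succ.ne
  have L1 : ∀ β, swapStr i β j.succ = β j.succ := fun β => swapStr_of_ne _ _ h1 h2
  have L2 : ∀ β, swapStr j β i.castSucc = β i.castSucc := fun β => swapStr_of_ne _ _ h3 h1.symm
  have L3 : ∀ β, swapStr j β i.succ = β j.succ := fun β => by rw [hij]; simp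
  have L4 : ∀ β, swapStr i β i.succ = β i.castSucc := fun β => by simp
  have e1 : ∀ β : Str n, β i.castSucc = β i.succ → v β = 0 := fun β hβ =>
    hv.eq_zero _ _ _ (by simp [IsDes, hβ]) (by simp [IsAsc, hβ])
  have e2 := hv.apply_of_isAsc q qN κ hα
  obtain ⟨ha, hb⟩ := hα
  simp only [refl, weight, heckePar] at e2
  rw [gen_mulVec_of_isAsc _ _ _ _ (i := some i) ⟨ha, hb⟩]
  simp only [gen_mulVec, IsDes, IsAsc, refl, ← hij, weight, heckePar, L1, L4, ha, hb]
  have f1 : α j.succ = true → v (swapStr j α) = 0 := fun hc => e1 _ (by rw [L2, L3, ha, hc])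
  have f2 : α j.succ = false → v (swapStr j (swapStr i α)) = 0 := fun hc =>
    e1 _ (by rw [L2, L3, swapStr_castSucc, L1, hb, hc])
  cases hc : α j.succ
  · simp [f2 hc, e2]
  · simp [f1 hc]

theorem gen_temperley_lieb_right {i j : Fin n} (hij : j.succ = i.castSucc) :
    gen q qN κ (some i) * gen q qN κ (some j) * gen q qN κ (some i) = gen q qN κ (some i) := by
  have := gen_mul_gen_mul_gen_of_inImage q qN κ (i := some i) (j := some j) 1 ?_
  · rwa [one_smul] at this
  intro v hv α hα
  have h1 : j.castSucc ≠ i.succ := by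
    simp only [Fin.ext_iff, Fin.val_succ, Fin.val_castSucc, ne_eq] at hij ⊢
    omega
  have h2 : j.castSucc ≠ i.castSucc := by rw [← hij]; exact j.castSucc_lt_succ.ne
  have h3 : i.succ ≠ j.succ := by rw [hij]; exact i.castSucc_lt_succ.ne'
  have L1 : ∀ β, swapStr i β j.castSucc = β j.castSucc := fun β => swapStr_of_ne _ _ h2 h1
  have L2 : ∀ β, swapStr j β i.succ = β i.succ := fun β => swapStr_of_ne _ _ h1.symm h3
  have L3 : ∀ β, swapStr j β i.castSucc = β j.castSucc := fun β => by rw [← hij]; simp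
  have L4 : ∀ β, swapStr i β i.castSucc = β i.succ := fun β => by simp
  have e1 : ∀ β : Str n, β i.castSucc = β i.succ → v β = 0 := fun β hβ =>
    hv.eq_zero _ _ _ (by simp [IsDes, hβ]) (by simp [IsAsc, hβ])
  have e2 := hv.apply_of_isAsc q qN κ hα
  obtain ⟨ha, hb⟩ := hα
  simp only [refl, weight, heckePar] at e2
  rw [gen_mulVec_of_isAsc _ _ _ _ (i := some i) ⟨ha, hb⟩]
  simp only [gen_mulVec, IsDes, IsAsc, refl, hij, weight, heckePar, L1, L4, ha, hb]
  have f1 : α j.castSucc = false → v (swapStr j α) = 0 := fun hc => e1 _ (by rw [L2, L3, hb, hc])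
  have f2 : α j.castSucc = true → v (swapStr j (swapStr i α)) = 0 := fun hc =>
    e1 _ (by rw [L2, L3, swapStr_succ, L1, ha, hc])
  cases hc : α j.castSucc
  · simp [f1 hc, e2]
  · simp [f2 hc, e2]

/-- A flip of the last letter of `(+, -)` or `(-, +)` produces equal letters, where the vector
vanishes. The diagonal entries `-q_N` and `-q_N⁻¹` of `e_N` remain, and `v_{-+} = -q v_{+-}` on
coordinates combines them into the constant. -/
theorem gen_blob_relation {i : Fin n} (hi : i.succ = Fin.last n) :
    gen q qN κ (some i) * gen q qN κ none * gen q qN κ (some i) =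
      ((q : R) * ↑qN⁻¹ + ↑q⁻¹ * qN) • gen q qN κ (some i) := by
  refine gen_mul_gen_mul_gen_of_inImage q qN κ (i := some i) (j := none) _ ?_
  intro v hv α hα
  have h3 : i.castSucc ≠ Fin.last n := by rw [← hi]; exact i.castSucc_lt_succ.ne
  have e1 : ∀ β : Str n, β i.castSucc = β (Fin.last n) → v β = 0 := fun β hβ =>
    hv.eq_zero _ _ _ (by simp [IsDes, hi, hβ]) (by simp [IsAsc, hi, hβ])
  have e2 := hv.apply_refl_of_isAsc q qN κ hα
  have L4 : swapStr i α (Fin.last n) = α i.castSucc := by rw [← hi]; simp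
  rw [gen_mulVec_of_isAsc _ _ _ _ hα]
  obtain ⟨ha, hb⟩ := hα
  rw [hi] at hb
  simp only [refl, weight, heckePar] at e2
  have f1 : v (flipStr α) = 0 := e1 _ (by rw [flipStr_of_ne _ h3]; simp [ha, hb])
  have f2 : v (flipStr (swapStr i α)) = 0 :=
    e1 _ (by rw [flipStr_of_ne _ h3, flipStr_last, L4]; simp [ha, hi, hb])
  simp only [gen_mulVec, IsDes, IsAsc, refl, weight, heckePar, L4, ha, hb, f1, f2, e2]
  simp
  ring

end Relations

/-! ### Scalars -/

section Scalars

theorem coe_monomialUnit (g : ℤ × ℤ × ℤ) :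
    (monomialUnit g : ParamRing) = AddMonoidAlgebra.single g 1 := rfl

theorem monomialUnit_add (g h : ℤ × ℤ × ℤ) :
    monomialUnit (g + h) = monomialUnit g * monomialUnit h := by
  simp [monomialUnit, ofAdd_add]

theorem monomialUnit_zero : monomialUnit 0 = 1 := by
  simp [monomialUnit]

theorem monomialUnit_neg (g : ℤ × ℤ × ℤ) : monomialUnit (-g) = (monomialUnit g)⁻¹ := by
  rw [eq_inv_iff_mul_eq_one, ← monomialUnit_add, neg_add_cancel, monomialUnit_zero]

theorem monomialUnit_nsmul (m : ℕ) (g : ℤ × ℤ × ℤ) :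
    monomialUnit (m • g) = monomialUnit g ^ m := by
  induction m with
  | zero => simp [monomialUnit_zero]
  | succ m ih => rw [succ_nsmul, monomialUnit_add, ih, pow_succ]

/-- The bar involution on exponents. -/
def expBar : ℤ × ℤ × ℤ →+ ℤ × ℤ × ℤ :=
  AddMonoidHom.prodMap (negAddMonoidHom : ℤ →+ ℤ)
    (AddMonoidHom.prodMap (negAddMonoidHom : ℤ →+ ℤ) (AddMonoidHom.id ℤ))

theorem expBar_apply (g : ℤ × ℤ × ℤ) : expBar g = (-g.1, -g.2.1, g.2.2) := rfl

theorem expBar_injective : Function.Injective expBar := by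
  intro g h hgh
  simpa [expBar_apply, Prod.ext_iff] using hgh

theorem scalarBar_apply (r : ParamRing) : scalarBar r = AddMonoidAlgebra.mapDomain expBar r := rfl

theorem scalarBar_monomialUnit (g : ℤ × ℤ × ℤ) :
    scalarBar (monomialUnit g : ParamRing) = (monomialUnit (expBar g) : ParamRing) := by
  rw [scalarBar_apply, coe_monomialUnit, AddMonoidAlgebra.mapDomain_single, coe_monomialUnit]

/-- The span of the negative monomials. -/
def KLType.negSpan (X : KLType) : AddSubgroup ParamRing where
  carrier := {r | ∀ g, r.coeff g ≠ 0 → g ∈ X.negMonomials}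
  zero_mem' := by simp
  add_mem' := by
    intro a b ha hb g hg
    by_contra hn
    have h1 : a.coeff g = 0 := by_contra fun h => hn (ha g h)
    have h2 : b.coeff g = 0 := by_contra fun h => hn (hb g h)
    simp [h1, h2] at hg
  neg_mem' := by
    intro a ha g hg
    exact ha g (by simpa using hg)

/-- Bar invariance makes the support stable under `expBar`, which reverses the exponents of `q` and
`q_N`; a negative monomial never has a negative image. -/
theorem eq_zero_of_scalarBar_eq {X : KLType} {r : ParamRing} (h : scalarBar r = r)
    (hr : r ∈ X.negSpan) : r = 0 := by
  by_contra hne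
  have : r.coeff ≠ 0 := fun h0 => hne (AddMonoidAlgebra.coeff_eq_zero.mp h0)
  obtain ⟨g, hg⟩ := Finsupp.ne_iff.mp this
  have h1 : r.coeff (expBar g) = r.coeff g := by
    conv_lhs => rw [← h, scalarBar_apply, AddMonoidAlgebra.coeff_mapDomain]
    exact Finsupp.mapDomain_apply expBar_injective _ _
  have h2 := hr g hg
  have h3 := hr (expBar g) (by rw [h1]; exact hg)
  rw [expBar_apply] at h3
  cases X <;> simp only [KLType.negMonomials, Set.mem_ofPred_eq] at h2 h3 <;> omega

theorem monomialUnit_mul_mem_negSpan {X : KLType} {g : ℤ × ℤ × ℤ}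
    (hg : ∀ h ∈ X.negMonomials, g + h ∈ X.negMonomials) {r : ParamRing} (hr : r ∈ X.negSpan) :
    (monomialUnit g : ParamRing) * r ∈ X.negSpan := by
  intro h hh
  rw [coe_monomialUnit, AddMonoidAlgebra.coeff_single_mul_apply, one_mul] at hh
  simpa using hg _ (hr _ hh)

theorem monomialUnit_mem_negSpan {X : KLType} {g : ℤ × ℤ × ℤ} (hg : g ∈ X.negMonomials) :
    (monomialUnit g : ParamRing) ∈ X.negSpan := by
  intro h hh
  rw [coe_monomialUnit, AddMonoidAlgebra.coeff_single, Finsupp.single_apply] at hh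
  split_ifs at hh with h1
  · exact h1 ▸ hg
  · exact absurd rfl hh

variable {n : ℕ}

/-- The exponent of a Hecke parameter. -/
def KLType.parExp (X : KLType) : Option (Fin n) → ℤ × ℤ × ℤ
  | some _ => (1, 0, 0)
  | none => match X with
    | .BI M => ((M : ℕ), 0, 0)
    | .BII => (0, 1, 0)
    | .BIII => (0, 1, 0)

/-- The exponent of an off-diagonal weight. -/
def weightExp : Option (Fin n) → ℤ × ℤ × ℤ
  | some _ => 0
  | none => (0, 0, 1)

theorem heckePar_eq (X : KLType) (i : Option (Fin n)) :
    heckePar qUnit X.qNUnit i = monomialUnit (X.parExp i) := by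
  cases i with
  | some i => rfl
  | none =>
    cases X with
    | BI M =>
      simp only [heckePar, KLType.qNUnit, KLType.parExp, qUnit, ← monomialUnit_nsmul]
      simp
    | BII => rfl
    | BIII => rfl

theorem weight_eq (i : Option (Fin n)) : weight κUnit i = monomialUnit (weightExp i) := by
  cases i with
  | some i => simp [weight, weightExp, monomialUnit_zero]
  | none => rfl

theorem scalarBar_weight (i : Option (Fin n)) :
    scalarBar (weight κUnit i : ParamRing) = weight κUnit i := by
  rw [weight_eq, scalarBar_monomialUnit]
  cases i <;> rfl

theorem scalarBar_heckePar (X : KLType) (i : Option (Fin n)) :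
    scalarBar (↑(heckePar qUnit X.qNUnit i)⁻¹ : ParamRing) = heckePar qUnit X.qNUnit i := by
  rw [heckePar_eq, ← monomialUnit_neg, scalarBar_monomialUnit]
  congr 2
  cases i <;> cases X <;> simp [KLType.parExp, expBar_apply]

theorem weight_mul_heckePar_inv (X : KLType) (i : Option (Fin n)) :
    (weight κUnit i : ParamRing) * ↑(heckePar qUnit X.qNUnit i)⁻¹ =
      monomialUnit (weightExp i - X.parExp i) := by
  rw [heckePar_eq, weight_eq, sub_eq_add_neg, monomialUnit_add, monomialUnit_neg, Units.val_mul]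

theorem weight_mul_heckePar_inv_mem (X : KLType) (i : Option (Fin n)) :
    (weight κUnit i : ParamRing) * ↑(heckePar qUnit X.qNUnit i)⁻¹ ∈ X.negSpan := by
  rw [weight_mul_heckePar_inv]
  apply monomialUnit_mem_negSpan
  cases i <;> cases X <;> simp [KLType.negMonomials, weightExp, KLType.parExp]

/-- The factors `q⁻¹` and `κ_N q_N⁻¹` are themselves negative monomials, and each `A_-` is closed
under products. -/
theorem weight_mul_heckePar_inv_mul_mem (X : KLType) (i : Option (Fin n)) {r : ParamRing}
    (hr : r ∈ X.negSpan) :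
    (weight κUnit i : ParamRing) * ↑(heckePar qUnit X.qNUnit i)⁻¹ * r ∈ X.negSpan := by
  rw [weight_mul_heckePar_inv]
  refine monomialUnit_mul_mem_negSpan (fun h hh => ?_) hr
  cases X with
  | BI M =>
    have := M.pos
    cases i <;> simp [KLType.negMonomials, weightExp, KLType.parExp] at hh ⊢ <;> omega
  | BII => cases i <;> simp [KLType.negMonomials, weightExp, KLType.parExp] at hh ⊢ <;> omega
  | BIII => cases i <;> simp [KLType.negMonomials, weightExp, KLType.parExp] at hh ⊢ <;> omega

end Scalars

/-! ### The bar involution -/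

section Bar

variable {n : ℕ} {X : KLType}

/-- Since `T = e + p⁻¹` and `T⁻¹ = e + p`, the scalar parts of `bar (T v)` and `T⁻¹ (bar v)` agree,
which leaves commutation with `e`. -/
theorem IsBar.gen_mulVec {bar : (Str n → ParamRing) → (Str n → ParamRing)} (h : IsBar n X bar)
    (i : Option (Fin n)) (v : Str n → ParamRing) :
    bar ((gen qUnit X.qNUnit κUnit i).mulVec v) =
      (gen qUnit X.qNUnit κUnit i).mulVec (bar v) := by
  set E : Matrix (Str n) (Str n) ParamRing := gen qUnit X.qNUnit κUnit i with hE
  set p := heckePar qUnit X.qNUnit i with hp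
  have hT : (E + (↑p⁻¹ : ParamRing) • 1).mulVec (bar ((E + (↑p⁻¹ : ParamRing) • 1).mulVec v)) =
      bar v := by
    cases i with
    | some i => exact h.map_bulk i v
    | none => exact h.map_bdry v
  have h1 : bar ((E + (↑p⁻¹ : ParamRing) • 1).mulVec v) =
      bar (E.mulVec v) + (p : ParamRing) • bar v := by
    rw [Matrix.add_mulVec, Matrix.smul_mulVec, Matrix.one_mulVec, h.map_add, h.map_smul,
      scalarBar_heckePar]
  -- The inverse of `T`, by the quadratic relation for `E`.
  have h2 : (E + (p : ParamRing) • 1) * (E + (↑p⁻¹ : ParamRing) • 1) = 1 := by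
    have hpp : (p : ParamRing) * ↑p⁻¹ = 1 := p.mul_inv
    rw [add_mul, mul_add, mul_add, hE, gen_mul_gen, ← hE, ← hp]
    simp only [Algebra.mul_smul_comm, Algebra.smul_mul_assoc, mul_one, one_mul, smul_smul,
      hpp, one_smul, mul_comm _ (p : ParamRing)]
    module
  have h3 := congrArg (E + (p : ParamRing) • (1 : Matrix (Str n) (Str n) ParamRing)).mulVec hT
  rw [Matrix.mulVec_mulVec, h2, Matrix.one_mulVec, h1, Matrix.add_mulVec, Matrix.smul_mulVec,
    Matrix.one_mulVec] at h3
  exact add_right_cancel h3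

theorem IsBar.map_sum {bar : (Str n → ParamRing) → (Str n → ParamRing)} (h : IsBar n X bar)
    {ι : Type*} (s : Finset ι) (f : ι → Str n → ParamRing) :
    bar (∑ b ∈ s, f b) = ∑ b ∈ s, bar (f b) :=
  _root_.map_sum (AddMonoidHom.mk' bar h.map_add) f s

end Bar

/-! ### Kazhdan-Lusztig bases -/

section KLBasis

variable {n : ℕ}

/-- The left hand sides of the relations `InImage`, as linear functionals. -/
def relFunctional {R : Type*} [CommRing R] (q qN κ : Rˣ) (i : Option (Fin n)) (α : Str n) :
    (Str n → R) →ₗ[R] R :=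
  LinearMap.proj α +
    (if IsAsc i α then ↑(weight κ i) * (↑(heckePar q qN i)⁻¹ : R) else 0) •
      LinearMap.proj (refl i α)

theorem inImage_iff {R : Type*} [CommRing R] (q qN κ : Rˣ) (i : Option (Fin n)) (v : Str n → R) :
    InImage q qN κ i v ↔ ∀ α, ¬ IsDes i α → relFunctional q qN κ i α v = 0 := by
  refine forall_congr' fun α => forall_congr' fun _ => ?_
  simp only [relFunctional, LinearMap.add_apply, LinearMap.smul_apply, LinearMap.proj_apply,
    smul_eq_mul, ite_mul, zero_mul]

/-- The matrix whose columns are the vectors `C ε`. -/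
def basisMatrix (C : Str n → Str n → ParamRing) : Matrix (Str n) (Str n) ParamRing :=
  Matrix.of fun ε' ε => C ε ε'

namespace IsKLBasis

variable {X : KLType} {C : Str n → Str n → ParamRing}

theorem mem_negSpan (hC : IsKLBasis n X C) {ε ε' : Str n} (h : ε ≠ ε') : C ε ε' ∈ X.negSpan := by
  rcases LexLT.trichotomous ε ε' with h' | h' | h'
  · rw [hC.upper _ _ h']; exact zero_mem _
  · exact absurd h' h
  · exact hC.lower _ _ h'

theorem mulVec_single (ε : Str n) : (basisMatrix C).mulVec (Pi.single ε 1) = C ε := by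
  funext ε'
  simp [basisMatrix]

theorem mulVec_eq_sum (μ : Str n → ParamRing) :
    (basisMatrix C).mulVec μ = ∑ ε, μ ε • C ε := by
  funext ε'
  simp [basisMatrix, Matrix.mulVec, dotProduct, mul_comm]

theorem exists_mulVec_eq (hC : IsKLBasis n X C) (v : Str n → ParamRing) :
    ∃ μ, (basisMatrix C).mulVec μ = v := by
  suffices h : ∀ ε : Str n, Pi.single ε 1 ∈ LinearMap.range (basisMatrix C).mulVecLin by
    have : v ∈ LinearMap.range (basisMatrix C).mulVecLin := by
      rw [pi_eq_sum_univ' v]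
      refine Submodule.sum_mem _ fun ε _ => Submodule.smul_mem _ _ ?_
      convert h ε using 1
    simpa using this
  intro ε
  induction ε using LexLT.wellFounded.induction with
  | _ ε ih =>
    have h1 : C ε = Pi.single ε 1 + ∑ ε' with LexLT ε' ε, C ε ε' • Pi.single ε' 1 := by
      funext γ
      simp only [Pi.add_apply, Finset.sum_apply, Pi.smul_apply, Pi.single_apply, smul_eq_mul,
        mul_ite, mul_one, mul_zero, Finset.sum_ite_eq, Finset.mem_filter, Finset.mem_univ, true_and]
      rcases LexLT.trichotomous γ ε with h | rfl | h
      · simp [h, h.ne]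
      · simp [LexLT.irrefl, hC.diag]
      · simp [h.asymm, h.ne.symm, hC.upper _ _ h]
    have h2 : (Pi.single ε 1 : Str n → ParamRing) =
        C ε - ∑ ε' with LexLT ε' ε, C ε ε' • Pi.single ε' 1 := by
      rw [eq_sub_iff_add_eq, ← h1]
    rw [h2]
    refine Submodule.sub_mem _ ⟨Pi.single ε 1, mulVec_single ε⟩ (Submodule.sum_mem _ ?_)
    intro ε' hε'
    exact Submodule.smul_mem _ _ (ih ε' (by simpa using hε'))

/-- Unitriangularity gives invertibility already over the Laurent polynomials, so it survives every
specialization of the parameters. -/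
theorem isUnit_basisMatrix (hC : IsKLBasis n X C) : IsUnit (basisMatrix C) := by
  choose f hf using hC.exists_mulVec_eq
  have : basisMatrix C * (Matrix.of fun a b => f (Pi.single b 1) a) = 1 := by
    refine Matrix.ext fun a b => ?_
    have := congrFun (hf (Pi.single b 1)) a
    rw [Matrix.mul_apply, Matrix.one_apply]
    simpa [Matrix.mulVec, dotProduct, Pi.single_apply] using this
  exact (Matrix.isUnit_iff_isUnit_det _).mpr (Matrix.isUnit_det_of_right_inverse this)

theorem mulVec_injective (hC : IsKLBasis n X C) : Function.Injective (basisMatrix C).mulVec :=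
  Matrix.mulVec_injective_of_isUnit hC.isUnit_basisMatrix

theorem mulVec_apply_of_forall (hC : IsKLBasis n X C) {μ : Str n → ParamRing} {γ : Str n}
    (h : ∀ δ, LexLT γ δ → μ δ = 0) : (basisMatrix C).mulVec μ γ = μ γ := by
  simp only [basisMatrix, Matrix.mulVec, dotProduct, Matrix.of_apply]
  rw [Finset.sum_eq_single γ, hC.diag, one_mul]
  · intro δ _ hδ
    rcases LexLT.trichotomous γ δ with h' | h' | h'
    · rw [h δ h', mul_zero]
    · exact absurd h'.symm hδ
    · rw [hC.upper _ _ h', zero_mul]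
  · simp

/-- The coordinates of a bar invariant vector are bar invariant. -/
theorem scalarBar_eq (hC : IsKLBasis n X C) {bar : (Str n → ParamRing) → (Str n → ParamRing)}
    (hbar : IsBar n X bar) (hCbar : ∀ ε, bar (C ε) = C ε) {μ : Str n → ParamRing}
    (h : bar ((basisMatrix C).mulVec μ) = (basisMatrix C).mulVec μ) (ε : Str n) :
    scalarBar (μ ε) = μ ε := by
  have h1 : bar ((basisMatrix C).mulVec μ) = (basisMatrix C).mulVec fun ε => scalarBar (μ ε) := by
    rw [mulVec_eq_sum, hbar.map_sum, mulVec_eq_sum]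
    refine Finset.sum_congr rfl fun ε _ => ?_
    rw [hbar.map_smul, hCbar]
  rw [h1] at h
  exact congrFun (hC.mulVec_injective h) ε

/-- Downward induction: once all `μ` above `γ` vanish, `μ γ` is the coordinate at `γ` of the vector,
hence both bar invariant and in the negative span. -/
theorem eq_zero_of_upper (hC : IsKLBasis n X C) {μ : Str n → ParamRing}
    (hμ : ∀ ε, scalarBar (μ ε) = μ ε) {β : Str n}
    (h : ∀ γ, LexLT β γ → (basisMatrix C).mulVec μ γ ∈ X.negSpan) (γ : Str n) (hγ : LexLT β γ) :
    μ γ = 0 := by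
  induction γ using LexLT.wellFounded_swap.induction with
  | _ γ ih =>
    have h1 := hC.mulVec_apply_of_forall fun δ hδ => ih δ hδ (hγ.trans hδ)
    exact eq_zero_of_scalarBar_eq (hμ γ) (h1 ▸ h γ hγ)

/-- For an ascent `γ` the relation also involves the larger string `refl i γ`; that is a descent,
where `μ` vanishes. So the relation at `γ` returns `μ γ` itself, and the uniqueness principle
applies. -/
theorem eq_zero_of_relFunctional (hC : IsKLBasis n X C) (i : Option (Fin n))
    {μ : Str n → ParamRing} (hμ : ∀ ε, scalarBar (μ ε) = μ ε) (hdes : ∀ ε, IsDes i ε → μ ε = 0)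
    (h : ∀ ε, ¬ IsDes i ε → relFunctional qUnit X.qNUnit κUnit i ε ((basisMatrix C).mulVec μ) ∈
      X.negSpan) (γ : Str n) : μ γ = 0 := by
  induction γ using LexLT.wellFounded_swap.induction with
  | _ γ ih =>
    by_cases hγ : IsDes i γ
    · exact hdes γ hγ
    refine eq_zero_of_scalarBar_eq (X := X) (hμ γ) ?_
    have h1 := h γ hγ
    have h2 := hC.mulVec_apply_of_forall ih
    simp only [relFunctional, LinearMap.add_apply, LinearMap.smul_apply, LinearMap.proj_apply, h2]
      at h1
    split_ifs at h1 with ha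
    · rw [hC.mulVec_apply_of_forall fun δ hδ => ih δ (ha.lexLT.trans hδ),
        hdes _ ((isDes_refl i γ).mpr ha)] at h1
      simpa using h1
    · simpa using h1

theorem relFunctional_mem (hC : IsKLBasis n X C) (i : Option (Fin n)) (α β : Str n) (hαβ : α ≠ β) :
    relFunctional qUnit X.qNUnit κUnit i β (C α) ∈ X.negSpan := by
  simp only [relFunctional, LinearMap.add_apply, LinearMap.smul_apply, LinearMap.proj_apply,
    smul_eq_mul]
  refine add_mem (hC.mem_negSpan hαβ) ?_
  split_ifs
  · by_cases h : α = refl i β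
    · rw [← h, hC.diag, mul_one]
      exact weight_mul_heckePar_inv_mem X i
    · exact weight_mul_heckePar_inv_mul_mem X i (hC.mem_negSpan h)
  · simp

/-- Above `β` the vector `C β` vanishes, so at a descent `γ` only `C β (refl i γ)` is left; its
value `1` at `γ = refl i β` is cancelled by the leading term of `C (refl i β)`. The factor `weight`
removes `κ_N⁻¹`, which is not allowed in `A_-`. -/
theorem weight_smul_gen_mulVec_mem (hC : IsKLBasis n X C) (i : Option (Fin n)) (β γ : Str n)
    (h : LexLT β γ) :
    ((weight κUnit i : ParamRing) • (gen qUnit X.qNUnit κUnit i).mulVec (C β) -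
      if IsAsc i β then C (refl i β) else 0) γ ∈ X.negSpan := by
  have h0 : C β γ = 0 := hC.upper _ _ h
  have hw : (weight κUnit i : ParamRing) * ↑(weight κUnit i)⁻¹ = 1 := Units.mul_inv _
  simp only [Pi.sub_apply, Pi.smul_apply, smul_eq_mul]
  by_cases hd : IsDes i γ
  · rw [gen_mulVec_of_isDes _ _ _ _ hd, h0, mul_zero, sub_zero, ← mul_assoc, hw, one_mul]
    by_cases hγ : refl i γ = β
    · subst hγ
      simp [hd, hC.diag]
    · refine sub_mem (hC.mem_negSpan (Ne.symm hγ)) ?_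
      split_ifs
      · exact hC.mem_negSpan (by rintro rfl; simp at hγ)
      · exact zero_mem _
  · have h1 : (gen qUnit X.qNUnit κUnit i).mulVec (C β) γ = 0 := by
      by_cases ha : IsAsc i γ
      · rw [gen_mulVec_of_isAsc _ _ _ _ ha, h0, hC.upper _ _ (h.trans ha.lexLT)]
        simp
      · exact gen_mulVec_of_not _ _ _ _ hd ha
    rw [h1, mul_zero, zero_sub]
    refine neg_mem ?_
    split_ifs with ha
    · exact hC.mem_negSpan (by rintro rfl; exact hd ((isDes_refl i β).mpr ha))
    · exact zero_mem _

/-- The vector `y`, a multiple of `e_i C_{s_i α}`, lies in the image and agrees with `C α` above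
`s_i α` up to the negative span. The difference is shown to be a combination of smaller `C γ` with
`γ` a descent, which lie in the image by induction. -/
theorem inImage_of_isDes (hC : IsKLBasis n X C) (i : Option (Fin n)) (α : Str n) (hα : IsDes i α) :
    InImage qUnit X.qNUnit κUnit i (C α) := by
  induction α using LexLT.wellFounded.induction with
  | _ α ih =>
    obtain ⟨bar, hbar, hCbar⟩ := hC.bar_invariant
    have hβ : IsAsc i (refl i α) := (isAsc_refl i α).mpr hα
    set y := (weight κUnit i : ParamRing) • (gen qUnit X.qNUnit κUnit i).mulVec (C (refl i α))
      with hy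
    have hyIm : InImage qUnit X.qNUnit κUnit i y := (inImage_gen_mulVec _ _ _ _ _).smul _ _ _ _
    have hybar : bar y = y := by
      rw [hy, hbar.map_smul, hbar.gen_mulVec, hCbar, scalarBar_weight]
    obtain ⟨μ, hμ⟩ := hC.exists_mulVec_eq (y - C α)
    have hμbar := hC.scalarBar_eq hbar hCbar (μ := μ) (by
      have h1 := hbar.map_add (y - C α) (C α)
      rw [sub_add_cancel, hybar, hCbar] at h1
      rw [hμ, ← sub_eq_of_eq_add h1])
    -- No `C γ` with `γ` above `s_i α` occurs in `y - C α`; in particular none with `γ ≥ α`.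
    have hμ0 := hC.eq_zero_of_upper hμbar (β := refl i α) (fun γ hγ => by
      have := hC.weight_smul_gen_mulVec_mem i (refl i α) γ hγ
      rw [if_pos hβ, refl_refl] at this
      rwa [hμ])
    set μ₁ : Str n → ParamRing := fun ε => if IsDes i ε then μ ε else 0
    set μ₂ : Str n → ParamRing := fun ε => if IsDes i ε then 0 else μ ε
    have hsum : (basisMatrix C).mulVec μ₁ + (basisMatrix C).mulVec μ₂ = y - C α := by
      rw [← Matrix.mulVec_add, ← hμ]
      congr 1
      funext ε
      by_cases h : IsDes i ε <;> simp [μ₁, μ₂, h]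
    have h1 : ∀ ε, ¬ IsDes i ε →
        relFunctional qUnit X.qNUnit κUnit i ε ((basisMatrix C).mulVec μ₁) = 0 := by
      intro ε hε
      rw [mulVec_eq_sum, map_sum]
      refine Finset.sum_eq_zero fun γ _ => ?_
      rw [map_smul]
      by_cases hd : IsDes i γ
      · by_cases hlt : LexLT γ α
        · rw [(inImage_iff _ _ _ _ _).mp (ih γ hlt hd) ε hε, smul_zero]
        · have : LexLT (refl i α) γ := by
            rcases LexLT.trichotomous γ α with h | rfl | h
            · exact absurd h hlt
            · exact hα.lexLT
            · exact hα.lexLT.trans h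
          simp [μ₁, hμ0 γ this]
      · simp [μ₁, hd]
    -- As `y` and the descent part satisfy the relations exactly, the remaining part satisfies them
    -- up to those of `C α`, which fail only by elements of the negative span.
    have h2 : ∀ ε, μ₂ ε = 0 := by
      refine hC.eq_zero_of_relFunctional i ?_ ?_ ?_
      · intro ε
        by_cases h : IsDes i ε <;> simp [μ₂, h, hμbar]
      · intro ε hε
        simp [μ₂, hε]
      · intro ε hε
        rw [eq_sub_of_add_eq' hsum, map_sub, map_sub, h1 ε hε,
          (inImage_iff _ _ _ _ _).mp hyIm ε hε, sub_zero, zero_sub]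
        exact neg_mem (hC.relFunctional_mem i α ε (by rintro rfl; exact hε hα))
    have h3 : C α = y - (basisMatrix C).mulVec μ₁ := by
      rw [show μ₂ = 0 from funext h2, Matrix.mulVec_zero, add_zero] at hsum
      rw [hsum, sub_sub_cancel]
    rw [inImage_iff]
    intro ε hε
    rw [h3, map_sub, h1 ε hε, (inImage_iff _ _ _ _ _).mp hyIm ε hε, sub_zero]

/-- The structure constants are found over the Laurent polynomials, where the bar involution exists;
they are specialized afterwards. -/
theorem exists_gen_mul_eq (hC : IsKLBasis n X C) (i : Option (Fin n)) :
     ∃ c : Matrix (Str n) (Str n) ParamRing,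
    gen qUnit X.qNUnit κUnit i * basisMatrix C = basisMatrix C * c ∧
    (∀ α β, ¬ IsDes i α → c α β = 0) ∧
    (∀ α β, IsDes i β → c α β = if α = β then
      -((heckePar qUnit X.qNUnit i : ParamRing) + ↑(heckePar qUnit X.qNUnit i)⁻¹) else 0) ∧
    (∀ α β, LexLT β α → weight κUnit i * c α β = if α = refl i β ∧ IsAsc i β then 1 else 0) := by
  obtain ⟨bar, hbar, hCbar⟩ := hC.bar_invariant
  choose μ hμ using fun β => hC.exists_mulVec_eq ((gen qUnit X.qNUnit κUnit i).mulVec (C β))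
  have hμbar : ∀ β ε, scalarBar (μ β ε) = μ β ε := fun β =>
    hC.scalarBar_eq hbar hCbar (by rw [hμ, hbar.gen_mulVec, hCbar])
  refine ⟨Matrix.of fun α β => μ β α, ?_, ?_, ?_, ?_⟩
  · refine Matrix.ext fun α β => ?_
    have := congrFun (hμ β) α
    simp only [Matrix.mulVec, dotProduct] at this
    rw [Matrix.mul_apply, Matrix.mul_apply]
    exact this.symm
  · intro α β hα
    -- Both `e_i C_β` and its descent part lie in the image, so the non-descent part satisfies the
    -- relations exactly.
    set μ₂ : Str n → ParamRing := fun ε => if IsDes i ε then 0 else μ β ε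
    suffices h : ∀ ε, μ₂ ε = 0 by simpa [μ₂, hα] using h α
    refine hC.eq_zero_of_relFunctional i ?_ ?_ ?_
    · intro ε
      by_cases h : IsDes i ε <;> simp [μ₂, h, hμbar]
    · intro ε hε
      simp [μ₂, hε]
    · intro ε hε
      have h1 : (basisMatrix C).mulVec μ₂ = (gen qUnit X.qNUnit κUnit i).mulVec (C β) -
          ∑ γ, (if IsDes i γ then μ β γ else 0) • C γ := by
        rw [← hμ, mulVec_eq_sum, mulVec_eq_sum, ← Finset.sum_sub_distrib]
        refine Finset.sum_congr rfl fun γ _ => ?_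
        by_cases h : IsDes i γ <;> simp [μ₂, h]
      rw [h1, map_sub, (inImage_iff _ _ _ _ _).mp (inImage_gen_mulVec _ _ _ _ _) ε hε, map_sum,
        Finset.sum_eq_zero, sub_zero]
      · exact zero_mem _
      intro γ _
      split_ifs with hd
      · rw [map_smul, (inImage_iff _ _ _ _ _).mp (hC.inImage_of_isDes i γ hd) ε hε, smul_zero]
      · simp
  · intro α β hβ
    have h1 : μ β = (-((heckePar qUnit X.qNUnit i : ParamRing) +
        ↑(heckePar qUnit X.qNUnit i)⁻¹)) • Pi.single β 1 := by
      apply hC.mulVec_injective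
      rw [hμ, (hC.inImage_of_isDes i β hβ).gen_mulVec_eq, Matrix.mulVec_smul, mulVec_single]
    simp [h1, Pi.single_apply]
  · intro α β hlt
    -- Above `β`, the bar invariant coordinates `ν` describe a vector in the negative span, so they
    -- vanish there.
    set ν : Str n → ParamRing := (weight κUnit i : ParamRing) • μ β -
      if IsAsc i β then Pi.single (refl i β) 1 else 0 with hν
    have h1 : (basisMatrix C).mulVec ν =
        (weight κUnit i : ParamRing) • (gen qUnit X.qNUnit κUnit i).mulVec (C β) -
          if IsAsc i β then C (refl i β) else 0 := by
      rw [hν, Matrix.mulVec_sub, Matrix.mulVec_smul, hμ]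
      split_ifs
      · rw [mulVec_single]
      · rw [Matrix.mulVec_zero]
    have h2 : ν α = 0 := by
      refine hC.eq_zero_of_upper (fun ε => ?_) (fun γ hγ => ?_) α hlt
      · simp only [hν, Pi.sub_apply, Pi.smul_apply, smul_eq_mul, _root_.map_sub, map_mul,
          scalarBar_weight, hμbar]
        congr 1
        split_ifs
        · rw [Pi.single_apply]; split_ifs <;> simp
        · simp
      · rw [h1]
        exact hC.weight_smul_gen_mulVec_mem i β γ hγ
    simp only [hν, Pi.sub_apply, Pi.smul_apply, smul_eq_mul] at h2
    rw [Matrix.of_apply, sub_eq_zero.mp h2]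
    by_cases ha : IsAsc i β <;> simp [ha, Pi.single_apply]

end IsKLBasis

end KLBasis

/-! ### Relations for two-term operators attached to involutions -/

section Operators

variable {k P : Type*} [Field k]

/-- The operator `f ↦ -(1 + s) (b ∘ s) f` attached to a map `s` and a coefficient function `b`. -/
def symOp (s : P → P) (b : P → k) : Module.End k (P → k) where
  toFun f z := -(b (s z) * f z + b z * f (s z))
  map_add' f g := by funext z; simp; ring
  map_smul' c f := by funext z; simp; ring

theorem symOp_apply (s : P → P) (b : P → k) (f : P → k) (z : P) :
    symOp s b f z = -(b (s z) * f z + b z * f (s z)) := rfl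

theorem symOp_mul_symOp {s : P → P} {b : P → k} {c : k} (hs : ∀ z, s (s z) = z)
    (hb : ∀ z, b z + b (s z) = c) : symOp s b * symOp s b = (-c) • symOp s b := by
  refine LinearMap.ext fun f => funext fun z => ?_
  simp only [Module.End.mul_apply, symOp_apply, LinearMap.smul_apply, Pi.smul_apply,
    smul_eq_mul, hs]
  rw [← hb z]
  ring

theorem symOp_comm {s t : P → P} {b c : P → k} (hst : ∀ z, s (t z) = t (s z))
    (hb : ∀ z, b (t z) = b z) (hc : ∀ z, c (s z) = c z) :
    symOp s b * symOp t c = symOp t c * symOp s b := by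
  refine LinearMap.ext fun f => funext fun z => ?_
  have hct : ∀ z, c (t (s z)) = c (t z) := fun z => by rw [← hst, hc]
  simp only [Module.End.mul_apply, symOp_apply, hst, hb, hc, hct]
  ring

theorem symOp_braid {s t : P → P} (q : kˣ) {x y w : P → k} (hs : ∀ z, s (s z) = z)
    (ht : ∀ z, t (t z) = z) (hst : ∀ z, s (t (s z)) = t (s (t z)))
    (hxs : ∀ z, x (s z) = y z) (hys : ∀ z, y (s z) = x z) (hws : ∀ z, w (s z) = w z)
    (hxt : ∀ z, x (t z) = x z) (hyt : ∀ z, y (t z) = w z) (hwt : ∀ z, w (t z) = y z)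
    (hxy : ∀ z, x z ≠ y z) {b c : P → k}
    (hb : ∀ z, b z = (y z - (q : k) ^ 2 * x z) / (q * (y z - x z)))
    (hc : ∀ z, c z = (w z - (q : k) ^ 2 * y z) / (q * (w z - y z))) :
    symOp s b * symOp t c * symOp s b - symOp s b =
      symOp t c * symOp s b * symOp t c - symOp t c := by
  refine LinearMap.ext fun f => funext fun z => ?_
  have h1 : y z - x z ≠ 0 := sub_ne_zero.mpr (hxy z).symm
  have h2 : w z - x z ≠ 0 := sub_ne_zero.mpr (by simpa [hxt, hyt] using (hxy (t z)).symm)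
  -- All three coordinates are distinct because `x ≠ y` holds at every point of the orbit.
  have h3 : w z - y z ≠ 0 :=
    sub_ne_zero.mpr (by simpa [hxt, hyt, hxs, hys, hws] using (hxy (t (s z))).symm)
  have h4 : x z - y z ≠ 0 := sub_ne_zero.mpr (hxy z)
  have h5 : x z - w z ≠ 0 := by rw [← neg_sub]; exact neg_ne_zero.mpr h2
  have h6 : y z - w z ≠ 0 := by rw [← neg_sub]; exact neg_ne_zero.mpr h3
  have hq : (q : k) ≠ 0 := q.ne_zero
  simp only [Module.End.mul_apply, symOp_apply, LinearMap.sub_apply, Pi.sub_apply, hst, hs, ht, hb,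
    hc, hxs, hys, hws, hxt, hyt, hwt]
  generalize x z = X at *
  generalize y z = Y at *
  generalize w z = W at *
  generalize (q : k) = q at *
  field_simp
  ring

/-- In the difference of the two sides the values of `f` at all but four orbit points cancel
identically. At `s z`, `t z`, `s (t z)` and `t (s z)` the coefficient is a multiple of the single
identity `h`. -/
theorem symOp_boundary_braid {s t : P → P} {b c : P → k} {m m' l : k} (hs : ∀ z, s (s z) = z)
    (ht : ∀ z, t (t z) = z) (hst : ∀ z, s (t (s (t z))) = t (s (t (s z))))
    (hb : ∀ z, b z + b (s z) = m) (hc : ∀ z, c z + c (t z) = m')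
    (hbts : ∀ z, b (t (s z)) = b (t z)) (hcst : ∀ z, c (s (t z)) = c (s z))
    (h : ∀ z, (m - b z - b (t z)) * c (s z) + (b z - b (t z)) * c z + m' * b (t z) = l) :
    symOp s b * symOp t c * symOp s b * symOp t c - l • (symOp s b * symOp t c) =
      symOp t c * symOp s b * symOp t c * symOp s b - l • (symOp t c * symOp s b) := by
  refine LinearMap.ext fun f => funext fun z => ?_
  have hb' : ∀ z, b (s z) = m - b z := fun z => eq_sub_of_add_eq' (hb z)
  have hc' : ∀ z, c (t z) = m' - c z := fun z => eq_sub_of_add_eq' (hc z)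
  simp only [Module.End.mul_apply, symOp_apply, LinearMap.sub_apply, Pi.sub_apply,
    LinearMap.smul_apply, Pi.smul_apply, smul_eq_mul, hst, hs, ht, hb', hc', hbts, hcst]
  linear_combination (b z * c (s z) * f (t (s z)) - c z * b (t z) * f (s (t z))
    + c z * (b (t z) - b z) * f (t z) + b z * (c z - c (s z)) * f (s z)) * h z

end Operators

/-! ### The operators on functions of `z` and their Hecke relations -/

section Points

section

variable {k : Type*} {n : ℕ}

@[simp] theorem swapPt_castSucc (i : Fin n) (z : Fin (n + 1) → k) :
    swapPt i z i.castSucc = z i.succ := by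
  simp [swapPt]

@[simp] theorem swapPt_succ (i : Fin n) (z : Fin (n + 1) → k) :
    swapPt i z i.succ = z i.castSucc := by
  simp [swapPt]

theorem swapPt_of_ne (i : Fin n) (z : Fin (n + 1) → k) {j : Fin (n + 1)} (h : j ≠ i.castSucc)
    (h' : j ≠ i.succ) : swapPt i z j = z j := by
  simp [swapPt, Equiv.swap_apply_of_ne_of_ne h h']

end

variable {k : Type*} [Field k] {n : ℕ}

/-- The action of the finite Weyl group generators on points. -/
def actPt : Option (Fin n) → (Fin (n + 1) → k) → (Fin (n + 1) → k)
  | some i, z => swapPt i z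
  | none, z => invPt z

/-- The coefficient functions of the operators. -/
def opCoeff (q qN ζ : kˣ) : Option (Fin n) → (Fin (n + 1) → k) → k
  | some i, z => (z i.succ - (q : k) ^ 2 * z i.castSucc) / (q * (z i.succ - z i.castSucc))
  | none, z => (1 + qN * (ζ - (ζ : k)⁻¹) * z (Fin.last n) - (qN : k) ^ 2 * z (Fin.last n) ^ 2)
      / (qN * (1 - z (Fin.last n) ^ 2))

@[simp] theorem invPt_last (z : Fin (n + 1) → k) :
    invPt z (Fin.last n) = (z (Fin.last n))⁻¹ := by
  simp [invPt]

theorem invPt_of_ne (z : Fin (n + 1) → k) {j : Fin (n + 1)} (h : j ≠ Fin.last n) :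
    invPt z j = z j := by
  simp [invPt, Function.update_of_ne h]

theorem actPt_of_not_isSite {i : Option (Fin n)} (z : Fin (n + 1) → k) {m : Fin (n + 1)}
    (h : ¬ IsSite i m) : actPt i z m = z m := by
  cases i with
  | none => exact invPt_of_ne _ h
  | some i => exact swapPt_of_ne _ _ (fun h' => h (Or.inl h')) (fun h' => h (Or.inr h'))

theorem actPt_congr {i : Option (Fin n)} {y z : Fin (n + 1) → k} (h : ∀ m, IsSite i m → y m = z m)
    {m : Fin (n + 1)} (hm : IsSite i m) : actPt i y m = actPt i z m := by
  cases i with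
  | none =>
    obtain rfl : m = Fin.last n := hm
    simp [actPt, h (Fin.last n) rfl]
  | some i =>
    rcases hm with rfl | rfl
    · simpa [actPt] using h i.succ (Or.inr rfl)
    · simpa [actPt] using h i.castSucc (Or.inl rfl)

theorem opCoeff_congr (q qN ζ : kˣ) {i : Option (Fin n)} {y z : Fin (n + 1) → k}
    (h : ∀ m, IsSite i m → y m = z m) : opCoeff q qN ζ i y = opCoeff q qN ζ i z := by
  cases i with
  | none => simp [opCoeff, h (Fin.last n) rfl]
  | some i => simp [opCoeff, h i.castSucc (Or.inl rfl), h i.succ (Or.inr rfl)]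

@[simp] theorem actPt_actPt (i : Option (Fin n)) (z : Fin (n + 1) → k) :
    actPt i (actPt i z) = z := by
  cases i with
  | none =>
    funext j
    by_cases h : j = Fin.last n
    · subst h; simp [actPt]
    · simp [actPt, invPt_of_ne _ h]
  | some i => funext j; simp [actPt, swapPt]

theorem Far.actPt_comm {i j : Option (Fin n)} (h : Far i j) (z : Fin (n + 1) → k) :
    actPt i (actPt j z) = actPt j (actPt i z) := by
  funext m
  by_cases hi : IsSite i m
  · rw [actPt_of_not_isSite _ (h m hi)]
    exact actPt_congr (fun m hm => actPt_of_not_isSite z (h m hm)) hi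
  · rw [actPt_of_not_isSite _ hi]
    by_cases hj : IsSite j m
    · exact actPt_congr (fun m hm => (actPt_of_not_isSite z (h.symm m hm)).symm) hj
    · rw [actPt_of_not_isSite _ hj, actPt_of_not_isSite _ hj, actPt_of_not_isSite _ hi]

theorem actPt_braid {i j : Fin n} (hij : i.succ = j.castSucc) (z : Fin (n + 1) → k) :
    actPt (some i) (actPt (some j) (actPt (some i) z)) =
      actPt (some j) (actPt (some i) (actPt (some j) z)) := by
  have h1 : j.succ ≠ i.castSucc := by
    simp only [Fin.ext_iff, Fin.val_succ, Fin.val_castSucc, ne_eq] at hij ⊢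
    omega
  have h2 : j.succ ≠ i.succ := by rw [hij]; exact j.castSucc_lt_succ.ne'
  have h3 : i.castSucc ≠ i.succ := i.castSucc_lt_succ.ne
  funext m
  simp only [actPt, swapPt, Function.comp_apply, ← hij]
  congr 1
  simp only [Equiv.swap_apply_def]
  grind

theorem actPt_boundary_braid {i : Fin n} (hi : i.succ = Fin.last n) (z : Fin (n + 1) → k) :
    actPt (some i) (actPt none (actPt (some i) (actPt none z))) =
      actPt none (actPt (some i) (actPt none (actPt (some i) z))) := by
  have h3 : i.castSucc ≠ Fin.last n := by rw [← hi]; exact i.castSucc_lt_succ.ne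
  funext m
  simp only [actPt, swapPt, invPt, Function.comp_apply, hi, Function.update_apply,
    Equiv.swap_apply_def]
  grind

variable {D : Set (Fin (n + 1) → k)}

theorem IsWeylDomain.actPt_mem (hD : IsWeylDomain D) (i : Option (Fin n)) {z : Fin (n + 1) → k}
    (hz : z ∈ D) : actPt i z ∈ D := by
  cases i with
  | none => exact hD.inv_mem z hz
  | some i => exact hD.swap_mem z hz i

/-- The action of the finite Weyl group generators on the domain. -/
def IsWeylDomain.act (hD : IsWeylDomain D) (i : Option (Fin n)) (z : D) : D :=
  ⟨actPt i z, hD.actPt_mem i z.2⟩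

theorem IsWeylDomain.act_act (hD : IsWeylDomain D) (i : Option (Fin n)) (z : D) :
    hD.act i (hD.act i z) = z :=
  Subtype.ext (show actPt i (actPt i z.1) = z.1 from actPt_actPt i z.1)

/-- All operators on functions; `none` is the boundary operator. -/
def eHat (q qN ζ : kˣ) : Option (Fin n) → ((Fin (n + 1) → k) → k) → (Fin (n + 1) → k) → k
  | some i => eHatBulk q i
  | none => eHatBdry qN ζ

/-- The operators on functions on the domain. -/
def hatOp (q qN ζ : kˣ) (hD : IsWeylDomain D) (i : Option (Fin n)) : Module.End k (D → k) :=
  symOp (hD.act i) fun z => opCoeff q qN ζ i z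

variable (q qN ζ : kˣ) (hD : IsWeylDomain D)

theorem opCoeff_add (i : Option (Fin n)) {z : Fin (n + 1) → k} (hz : z ∈ D)
    (hD : IsWeylDomain D) : opCoeff q qN ζ i z + opCoeff q qN ζ i (actPt i z) =
      heckePar q qN i + (↑(heckePar q qN i)⁻¹ : k) := by
  cases i with
  | some i =>
    have h1 : z i.succ - z i.castSucc ≠ 0 := sub_ne_zero.mpr (hD.ne_adjacent z hz i).symm
    have h2 : z i.castSucc - z i.succ ≠ 0 := sub_ne_zero.mpr (hD.ne_adjacent z hz i)
    have hq : (q : k) ≠ 0 := q.ne_zero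
    simp only [opCoeff, actPt, swapPt_castSucc, swapPt_succ, heckePar, Units.val_inv_eq_inv_val]
    field_simp
    ring
  | none =>
    have h0 := hD.ne_zero z hz (Fin.last n)
    have h1 : 1 - z (Fin.last n) ^ 2 ≠ 0 := sub_ne_zero.mpr (hD.last_sq_ne_one z hz).symm
    have h2 : 1 - (z (Fin.last n))⁻¹ ^ 2 ≠ 0 := by
      have := sub_ne_zero.mpr (hD.last_sq_ne_one _ (hD.inv_mem z hz)).symm
      rwa [invPt_last] at this
    have h3 : z (Fin.last n) ^ 2 - 1 ≠ 0 := sub_ne_zero.mpr (hD.last_sq_ne_one z hz)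
    have hq : (qN : k) ≠ 0 := qN.ne_zero
    have hζ : (ζ : k) ≠ 0 := ζ.ne_zero
    simp only [opCoeff, actPt, invPt_last, heckePar, Units.val_inv_eq_inv_val]
    field_simp
    ring

/-- Because `b + b ∘ s` is the constant `p + p⁻¹` (`opCoeff_add`), the operator `-(p + p⁻¹) - b (s -
1)` takes the symmetric two-term form. The relations need nonvanishing denominators, hence functions
on `D` only. -/
theorem eHat_eq_hatOp (i : Option (Fin n)) (f : (Fin (n + 1) → k) → k) (z : D) :
    eHat q qN ζ i f z = hatOp q qN ζ hD i (fun z => f z) z := by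
  have hsum := opCoeff_add q qN ζ i z.2 hD
  have h1 : eHat q qN ζ i f z = -((heckePar q qN i : k) + (↑(heckePar q qN i)⁻¹ : k)) * f z
      - opCoeff q qN ζ i z * (f (actPt i z) - f z) := by
    obtain ⟨z, hz⟩ := z
    cases i with
    | some i =>
      have h1 : z i.succ - z i.castSucc ≠ 0 := sub_ne_zero.mpr (hD.ne_adjacent z hz i).symm
      have h2 := hD.ne_zero z hz i.succ
      have h3 : 1 - z i.castSucc * (z i.succ)⁻¹ ≠ 0 := by
        intro h
        apply h1
        field_simp at h
        simpa using h
      have hq : (q : k) ≠ 0 := q.ne_zero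
      have h4 : (q : k)⁻¹ * ((1 - (q : k) ^ 2 * z i.castSucc * (z i.succ)⁻¹)
          / (1 - z i.castSucc * (z i.succ)⁻¹)) = opCoeff q qN ζ (some i) z := by
        simp only [opCoeff]
        field_simp
      simp only [eHat, eHatBulk, tHatBulk, h4, heckePar, Units.val_inv_eq_inv_val, actPt]
      ring
    | none =>
      have h1 : 1 - z (Fin.last n) ^ 2 ≠ 0 := sub_ne_zero.mpr (hD.last_sq_ne_one z hz).symm
      have hq : (qN : k) ≠ 0 := qN.ne_zero
      have hζ : (ζ : k) ≠ 0 := ζ.ne_zero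
      have h4 : (qN : k)⁻¹ * (((1 + (qN : k) * ζ * z (Fin.last n)) *
          (1 - (qN : k) * (ζ : k)⁻¹ * z (Fin.last n))) / (1 - z (Fin.last n) ^ 2)) =
          opCoeff q qN ζ none z := by
        simp only [opCoeff]
        field_simp
        ring
      simp only [eHat, eHatBdry, tHatBdry, h4, heckePar, Units.val_inv_eq_inv_val, actPt]
      ring
  rw [h1, ← hsum]
  simp only [hatOp, symOp_apply, IsWeylDomain.act]
  ring

theorem hatOp_mul_hatOp (i : Option (Fin n)) : hatOp q qN ζ hD i * hatOp q qN ζ hD i =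
    (-((heckePar q qN i : k) + (↑(heckePar q qN i)⁻¹ : k))) • hatOp q qN ζ hD i :=
  symOp_mul_symOp (hD.act_act i) fun z => opCoeff_add q qN ζ i z.2 hD

theorem Far.hatOp_comm {i j : Option (Fin n)} (h : Far i j) :
    hatOp q qN ζ hD i * hatOp q qN ζ hD j = hatOp q qN ζ hD j * hatOp q qN ζ hD i :=
  symOp_comm (fun z => Subtype.ext (show actPt i (actPt j z.1) = _ from h.actPt_comm z.1))
    (fun _ => opCoeff_congr q qN ζ fun m hm => actPt_of_not_isSite _ (h m hm))
    (fun _ => opCoeff_congr q qN ζ fun m hm => actPt_of_not_isSite _ (h.symm m hm))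

/-- This is the Hecke braid relation for `T = e + q⁻¹`, rewritten for `e`. The two sides need not
vanish here, whereas they do for the matrices `e_i`. -/
theorem hatOp_braid {i j : Fin n} (hij : i.succ = j.castSucc) :
    hatOp q qN ζ hD (some i) * hatOp q qN ζ hD (some j) * hatOp q qN ζ hD (some i)
        - hatOp q qN ζ hD (some i) =
      hatOp q qN ζ hD (some j) * hatOp q qN ζ hD (some i) * hatOp q qN ζ hD (some j)
        - hatOp q qN ζ hD (some j) := by
  have h1 : j.succ ≠ i.castSucc := by
    simp only [Fin.ext_iff, Fin.val_succ, Fin.val_castSucc, ne_eq] at hij ⊢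
    omega
  have h2 : j.succ ≠ i.succ := by rw [hij]; exact j.castSucc_lt_succ.ne'
  have h3 : i.castSucc ≠ j.castSucc := by rw [← hij]; exact i.castSucc_lt_succ.ne
  refine symOp_braid q (x := fun z => z.1 i.castSucc) (y := fun z => z.1 i.succ)
    (w := fun z => z.1 j.succ) (hD.act_act (some i))
    (hD.act_act (some j))
    (fun z => Subtype.ext (show actPt (some i) _ = _ from actPt_braid hij z.1))
    (fun z => swapPt_castSucc _ _) (fun z => swapPt_succ _ _) (fun z => swapPt_of_ne _ _ h1 h2)
    (fun z => swapPt_of_ne _ _ h3 h1.symm) (fun z => ?_) (fun z => ?_)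
    (fun z => hD.ne_adjacent z z.2 i) (fun z => rfl) (fun z => ?_)
  · rw [hij]; exact swapPt_castSucc _ _
  · rw [hij]; exact swapPt_succ _ _
  · rw [hij]; rfl

theorem hatOp_boundary_braid {i : Fin n} (hi : i.succ = Fin.last n) :
    hatOp q qN ζ hD (some i) * hatOp q qN ζ hD none * hatOp q qN ζ hD (some i) *
        hatOp q qN ζ hD none - ((q : k) * ↑qN⁻¹ + ↑q⁻¹ * qN) •
          (hatOp q qN ζ hD (some i) * hatOp q qN ζ hD none) =
      hatOp q qN ζ hD none * hatOp q qN ζ hD (some i) * hatOp q qN ζ hD none *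
        hatOp q qN ζ hD (some i) - ((q : k) * ↑qN⁻¹ + ↑q⁻¹ * qN) •
          (hatOp q qN ζ hD none * hatOp q qN ζ hD (some i)) := by
  have h3 : i.castSucc ≠ Fin.last n := by rw [← hi]; exact i.castSucc_lt_succ.ne
  have hq : (q : k) ≠ 0 := q.ne_zero
  have hp : (qN : k) ≠ 0 := qN.ne_zero
  have L : ∀ z : Fin (n + 1) → k, swapPt i z (Fin.last n) = z i.castSucc := fun z => by
    rw [← hi, swapPt_succ]
  have L' : ∀ z : Fin (n + 1) → k, swapPt i z i.castSucc = z (Fin.last n) := fun z => by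
    rw [← hi, swapPt_castSucc]
  have hne : ∀ z ∈ D, z (Fin.last n) - z i.castSucc ≠ 0 := fun z hz => by
    rw [← hi]; exact sub_ne_zero.mpr (hD.ne_adjacent z hz i).symm
  -- Distinctness of the last two coordinates, applied after inverting the last one.
  have hmul : ∀ z ∈ D, 1 - z i.castSucc * z (Fin.last n) ≠ 0 := fun z hz h => by
    apply hne _ (hD.inv_mem z hz)
    rw [invPt_last, invPt_of_ne _ h3, sub_eq_zero, inv_eq_of_mul_eq_one_left]
    exact (sub_eq_zero.mp h).symm
  have hinv : ∀ z ∈ D, (z (Fin.last n))⁻¹ - z i.castSucc ≠ 0 := fun z hz => by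
    have := hne _ (hD.inv_mem z hz)
    rwa [invPt_last, invPt_of_ne _ h3] at this
  refine symOp_boundary_braid (hD.act_act _)
    (hD.act_act _) (fun z => Subtype.ext (actPt_boundary_braid hi z.1))
    (fun z => opCoeff_add q qN ζ (some i) z.2 hD) (fun z => opCoeff_add q qN ζ none z.2 hD)
    (fun z => ?_) (fun z => ?_) (fun z => ?_)
  · obtain ⟨z, hz⟩ := z
    have h1 := hinv z hz
    have h2 := hinv _ (hD.swap_mem z hz i)
    have h5 := hD.ne_zero z hz i.castSucc
    have h6 := hD.ne_zero z hz (Fin.last n)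
    simp only [IsWeylDomain.act, opCoeff, actPt, hi, invPt_last, invPt_of_ne _ h3, L, L'] at *
    rw [div_eq_div_iff (mul_ne_zero hq h2) (mul_ne_zero hq h1)]
    field_simp
  · simp only [IsWeylDomain.act, opCoeff, actPt, L, invPt_of_ne _ h3]
  · obtain ⟨z, hz⟩ := z
    have h1 := hinv z hz
    have h2 := hne z hz
    have h4 : 1 - z (Fin.last n) * z i.castSucc ≠ 0 := by rw [mul_comm]; exact hmul z hz
    have h5 := hD.ne_zero z hz i.castSucc
    have h6 := hD.ne_zero z hz (Fin.last n)
    have h7 : 1 - z (Fin.last n) ^ 2 ≠ 0 := sub_ne_zero.mpr (hD.last_sq_ne_one z hz).symm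
    have h8 : 1 - z i.castSucc ^ 2 ≠ 0 := by
      have := sub_ne_zero.mpr (hD.last_sq_ne_one _ (hD.swap_mem z hz i)).symm
      rwa [L] at this
    simp only [IsWeylDomain.act, opCoeff, actPt, hi, invPt_last, invPt_of_ne _ h3, L, heckePar,
      Units.val_inv_eq_inv_val]
    have h9 : ((z (Fin.last n))⁻¹ - (q : k) ^ 2 * z i.castSucc) /
        (q * ((z (Fin.last n))⁻¹ - z i.castSucc)) =
        (1 - (q : k) ^ 2 * z i.castSucc * z (Fin.last n)) /
          (q * (1 - z (Fin.last n) * z i.castSucc)) := by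
      rw [div_eq_div_iff (mul_ne_zero hq h1) (mul_ne_zero hq h4)]
      field_simp
    rw [h9]
    -- The parameter `ζ` enters only through this difference.
    generalize (ζ : k) - (ζ : k)⁻¹ = u
    field_simp
    ring

end Points

/-! ### Specialization -/

section Specialization

variable {k : Type*} [Field k] {n : ℕ}

theorem specialize_monomialUnit (q qN κ : kˣ) (g : ℤ × ℤ × ℤ) :
    Units.map (specialize q qN κ : ParamRing →* k) (monomialUnit g) =
      q ^ g.1 * qN ^ g.2.1 * κ ^ g.2.2 := by
  refine Units.ext ?_
  rw [Units.coe_map, coe_monomialUnit]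
  change AddMonoidAlgebra.lift ℤ k (ℤ × ℤ × ℤ) _ _ = _
  rw [AddMonoidAlgebra.lift_single, one_smul]
  rfl

theorem specialize_qNUnit (X : KLType) {q qN κ : kˣ}
    (hX : ∀ M : ℕ+, X = KLType.BI M → qN = q ^ (M : ℕ)) :
    Units.map (specialize q qN κ : ParamRing →* k) X.qNUnit = qN := by
  cases X with
  | BI M => rw [KLType.qNUnit, map_pow, qUnit, specialize_monomialUnit, hX M rfl]; simp
  | BII => simp [KLType.qNUnit, specialize_monomialUnit]
  | BIII => simp [KLType.qNUnit, specialize_monomialUnit]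

theorem gen_map {R S : Type*} [CommRing R] [CommRing S] (φ : R →+* S) (q qN κ : Rˣ)
    (i : Option (Fin n)) : (gen q qN κ i).map φ =
      gen (Units.map (φ : R →* S) q) (Units.map (φ : R →* S) qN) (Units.map (φ : R →* S) κ) i := by
  have h1 : weight (Units.map (φ : R →* S) κ) i = Units.map (φ : R →* S) (weight κ i) := by
    cases i <;> simp [weight]
  have h2 : heckePar (Units.map (φ : R →* S) q) (Units.map (φ : R →* S) qN) i =
      Units.map (φ : R →* S) (heckePar q qN i) := by
    cases i <;> simp [heckePar]
  refine Matrix.ext fun α β => ?_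
  rw [Matrix.map_apply, gen_apply, gen_apply, h1, h2, ← map_inv, ← map_inv]
  split_ifs <;> simp

theorem klMatrix_eq_map (q qN κ : kˣ) (C : Str n → Str n → ParamRing) :
    klMatrix q qN κ C = (basisMatrix C).map (specialize q qN κ) := rfl

variable {X : KLType} {q qN κ : kˣ} {C : Str n → Str n → ParamRing}

theorem IsKLBasis.isUnit_klMatrix (hC : IsKLBasis n X C) : IsUnit (klMatrix q qN κ C) := by
  rw [klMatrix_eq_map]
  exact hC.isUnit_basisMatrix.map (specialize q qN κ).mapMatrix

theorem IsKLBasis.klMatrix_mul_klCoeff (hC : IsKLBasis n X C) (E : Matrix (Str n) (Str n) k) :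
    klMatrix q qN κ C * klCoeff q qN κ C E = E * klMatrix q qN κ C := by
  rw [klCoeff, mul_assoc, Matrix.mul_nonsing_inv_cancel_left _ _
    ((Matrix.isUnit_iff_isUnit_det _).mp hC.isUnit_klMatrix)]

theorem IsKLBasis.klCoeff_mul (hC : IsKLBasis n X C) (E E' : Matrix (Str n) (Str n) k) :
    klCoeff q qN κ C (E * E') = klCoeff q qN κ C E * klCoeff q qN κ C E' := by
  rw [klCoeff, klCoeff, mul_assoc _ E, mul_assoc, mul_assoc _ (E * _), mul_assoc E E',
    mul_assoc E (klMatrix q qN κ C), hC.klMatrix_mul_klCoeff]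

theorem klCoeff_smul (a : k) (E : Matrix (Str n) (Str n) k) :
    klCoeff q qN κ C (a • E) = a • klCoeff q qN κ C E := by
  simp [klCoeff]

/-- The generic structure constants specialize because the generic basis matrix stays invertible.
`hX` makes the value of the boundary parameter equal to `qN` in type BI. -/
theorem IsKLBasis.klCoeff_gen (hC : IsKLBasis n X C)
    (hX : ∀ M : ℕ+, X = KLType.BI M → qN = q ^ (M : ℕ)) (i : Option (Fin n)) :
    (∀ α β, ¬ IsDes i α → klCoeff q qN κ C (gen q qN κ i) α β = 0) ∧
    (∀ α β, IsDes i β → klCoeff q qN κ C (gen q qN κ i) α β =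
      if α = β then -((heckePar q qN i : k) + ↑(heckePar q qN i)⁻¹) else 0) ∧
    (∀ α β, LexLT β α → klCoeff q qN κ C (gen q qN κ i) α β =
      if α = refl i β ∧ IsAsc i β then ↑(weight κ i)⁻¹ else 0) := by
  obtain ⟨c, hc, h1, h2, h3⟩ := hC.exists_gen_mul_eq i
  set φ := specialize q qN κ with hφ
  have hq : Units.map (φ : ParamRing →* k) qUnit = q := by
    simp [φ, qUnit, specialize_monomialUnit]
  have hqN : Units.map (φ : ParamRing →* k) X.qNUnit = qN := specialize_qNUnit X hX
  have hκ : Units.map (φ : ParamRing →* k) κUnit = κ := by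
    simp [φ, κUnit, specialize_monomialUnit]
  have hp : φ (heckePar qUnit X.qNUnit i : ParamRing) = heckePar q qN i := by
    cases i
    · exact congrArg Units.val hqN
    · exact congrArg Units.val hq
  have hp' : φ (↑(heckePar qUnit X.qNUnit i)⁻¹ : ParamRing) = ↑(heckePar q qN i)⁻¹ := by
    rw [Units.val_inv_eq_inv_val, ← hp]
    exact eq_inv_of_mul_eq_one_left (by rw [← map_mul, Units.inv_mul, map_one])
  have hw : φ (weight κUnit i : ParamRing) = weight κ i := by
    cases i
    · exact congrArg Units.val hκ
    · simp [weight]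
  have hmap : klCoeff q qN κ C (gen q qN κ i) = c.map φ := by
    have h := congrArg (fun A => A.map φ) hc
    simp only [Matrix.map_mul, gen_map, hq, hqN, hκ] at h
    rw [← klMatrix_eq_map] at h
    rw [klCoeff, mul_assoc, h, Matrix.nonsing_inv_mul_cancel_left _ _
      ((Matrix.isUnit_iff_isUnit_det _).mp hC.isUnit_klMatrix)]
  rw [hmap]
  refine ⟨fun α β hα => ?_, fun α β hβ => ?_, fun α β hlt => ?_⟩
  · rw [Matrix.map_apply, h1 α β hα, map_zero]
  · rw [Matrix.map_apply, h2 α β hβ]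
    split_ifs
    · rw [map_neg, map_add, hp, hp']
    · rw [map_zero]
  · have h := congrArg φ (h3 α β hlt)
    rw [map_mul, hw] at h
    rw [Matrix.map_apply]
    have hw0 : (weight κ i : k) ≠ 0 := (weight κ i).ne_zero
    split_ifs at h ⊢
    · rw [map_one] at h
      rw [Units.val_inv_eq_inv_val]
      exact eq_inv_of_mul_eq_one_right h
    · rw [map_zero] at h
      exact (mul_eq_zero.mp h).resolve_left hw0

end Specialization

/-! ### Propagation of the equations -/

section Propagation

variable {k : Type*} [Field k] {n : ℕ} {F : Type*} [AddCommGroup F] [Module k F]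

/-- The `α`-component of the equation between the matrix `A`, acting on vectors, and the operator
`S`, acting on components. -/
def Intertwines (A : Matrix (Str n) (Str n) k) (S : Module.End k F) (ψ : Str n → F) (α : Str n) :
    Prop :=
  S (ψ α) = ∑ β, A α β • ψ β

namespace Intertwines

variable {A B : Matrix (Str n) (Str n) k} {S T : Module.End k F} {ψ : Str n → F} {α α' : Str n}

theorem add (h : Intertwines A S ψ α) (h' : Intertwines B T ψ α) :
    Intertwines (A + B) (S + T) ψ α := by
  simp only [Intertwines] at *
  simp [h, h', add_smul, Finset.sum_add_distrib]

theorem sub (h : Intertwines A S ψ α) (h' : Intertwines B T ψ α) :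
    Intertwines (A - B) (S - T) ψ α := by
  simp only [Intertwines] at *
  simp [h, h', sub_smul, Finset.sum_sub_distrib]

theorem smul (h : Intertwines A S ψ α) (a : k) : Intertwines (a • A) (a • S) ψ α := by
  simp only [Intertwines] at *
  simp [h, Finset.smul_sum, smul_smul]

theorem apply_eq (h : Intertwines B T ψ α) : (S * T) (ψ α) = ∑ β, B α β • S (ψ β) := by
  rw [Module.End.mul_apply, show T (ψ α) = _ from h, map_sum]
  simp

theorem sum_mul (A B : Matrix (Str n) (Str n) k) (ψ : Str n → F) (α : Str n) :
    ∑ β, (B * A) α β • ψ β = ∑ β, B α β • ∑ γ, A β γ • ψ γ := by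
  simp only [Matrix.mul_apply, Finset.sum_smul, Finset.smul_sum, smul_smul]
  exact Finset.sum_comm

/-- The order of factors is reversed: operators act on components, matrices mix them, and the two
actions commute. -/
theorem mul (h : Intertwines B T ψ α) (h' : ∀ β, B α β ≠ 0 → Intertwines A S ψ β) :
    Intertwines (B * A) (S * T) ψ α := by
  rw [Intertwines, h.apply_eq, sum_mul]
  refine Finset.sum_congr rfl fun β _ => ?_
  by_cases hβ : B α β = 0
  · simp [hβ]
  · rw [show S (ψ β) = _ from h' β hβ]

/-- Both sides of the equation for the product are sums over row `α'` of `B`. All terms but the one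
at `α` are known to agree, and its coefficient can be cancelled. -/
theorem of_mul (h : Intertwines B T ψ α') (hBA : Intertwines (B * A) (S * T) ψ α')
    (hne : B α' α ≠ 0) (h' : ∀ β, β ≠ α → B α' β ≠ 0 → Intertwines A S ψ β) :
    Intertwines A S ψ α := by
  rw [Intertwines, h.apply_eq, sum_mul, ← Finset.add_sum_erase _ _ (Finset.mem_univ α),
    ← Finset.add_sum_erase _ _ (Finset.mem_univ α)] at hBA
  have hsum : ∑ β ∈ Finset.univ.erase α, B α' β • S (ψ β) =
      ∑ β ∈ Finset.univ.erase α, B α' β • ∑ γ, A β γ • ψ γ := by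
    refine Finset.sum_congr rfl fun β hβ => ?_
    by_cases h0 : B α' β = 0
    · simp [h0]
    · rw [show S (ψ β) = _ from h' β (Finset.ne_of_mem_erase hβ) h0]
  rw [hsum] at hBA
  exact smul_right_injective F hne (add_right_cancel hBA)

end Intertwines

/-- A string other than `(- ⋯ -)` has an ascent. -/
theorem exists_isAsc {α : Str n} (h : α ≠ minusStr n) : ∃ j, IsAsc j α := by
  obtain ⟨m, hm⟩ := Function.ne_iff.mp h
  have hm' : α m = true := by simpa [minusStr] using hm
  -- The last `+` is either at the boundary or followed by `-`.
  obtain ⟨l, hl, hmax⟩ := (wellFounded_gt (α := Fin (n + 1))).has_min {l | α l = true} ⟨m, hm'⟩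
  by_cases hlast : l = Fin.last n
  · subst hlast
    exact ⟨none, hl⟩
  · obtain ⟨i, rfl⟩ := Fin.exists_castSucc_eq.mpr hlast
    refine ⟨some i, hl, ?_⟩
    by_contra hs
    exact hmax i.succ (by simpa using hs) i.castSucc_lt_succ

theorem eq_or_far_or_adjacent (i j : Option (Fin n)) : i = j ∨ Far i j ∨
    (∃ a b : Fin n, i = some a ∧ j = some b ∧ (a.succ = b.castSucc ∨ b.succ = a.castSucc)) ∨
    (∃ a : Fin n, a.succ = Fin.last n ∧ ((i = some a ∧ j = none) ∨ (i = none ∧ j = some a))) := by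
  cases i with
  | none =>
    cases j with
    | none => exact Or.inl rfl
    | some b =>
      by_cases hb : b.succ = Fin.last n
      · exact Or.inr (Or.inr (Or.inr ⟨b, hb, Or.inr ⟨rfl, rfl⟩⟩))
      · refine Or.inr (Or.inl ?_)
        rintro m rfl (h | h)
        · exact b.castSucc_lt_last.ne h.symm
        · exact hb h.symm
  | some a =>
    cases j with
    | none =>
      by_cases ha : a.succ = Fin.last n
      · exact Or.inr (Or.inr (Or.inr ⟨a, ha, Or.inl ⟨rfl, rfl⟩⟩))
      · refine Or.inr (Or.inl ?_)
        rintro m (h | h) rfl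
        · exact a.castSucc_lt_last.ne h.symm
        · exact ha h.symm
    | some b =>
      by_cases hab : a = b
      · exact Or.inl (by rw [hab])
      by_cases h1 : a.succ = b.castSucc
      · exact Or.inr (Or.inr (Or.inl ⟨a, b, rfl, rfl, Or.inl h1⟩))
      by_cases h2 : b.succ = a.castSucc
      · exact Or.inr (Or.inr (Or.inl ⟨a, b, rfl, rfl, Or.inr h2⟩))
      refine Or.inr (Or.inl ?_)
      rintro m (rfl | rfl) (h | h)
      · exact hab (Fin.castSucc_injective _ h)
      · exact h2 h.symm
      · exact h1 h
      · exact hab (Fin.succ_injective _ h)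

/-- `α` is smaller than `β` because of a place before `a`. -/
def PrefixLT (a : ℕ) (α β : Str n) : Prop :=
  ∃ m : Fin (n + 1), (m : ℕ) < a ∧ (∀ l, l < m → α l = β l) ∧ α m = true ∧ β m = false

theorem PrefixLT.lexLT {a : ℕ} {α β : Str n} : PrefixLT a α β → LexLT α β :=
  fun ⟨m, _, h⟩ => ⟨m, h⟩

theorem PrefixLT.refl {a : ℕ} {α β : Str n} (h : PrefixLT a α β) {i : Option (Fin n)}
    (hi : ∀ m, IsSite i m → a ≤ (m : ℕ)) : PrefixLT a α (refl i β) := by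
  obtain ⟨m, hm, h1, h2, h3⟩ := h
  have hsite : ∀ l : Fin (n + 1), l ≤ m → BoundaryQKZ.refl i β l = β l := fun l hl =>
    refl_of_not_isSite β fun hs => absurd (hi l hs) (by have := Fin.le_def.mp hl; omega)
  exact ⟨m, hm, fun l hl => (h1 l hl).trans (hsite l hl.le).symm, h2, (hsite m le_rfl).trans h3⟩

/-- On the places from `a` up to `b` the string `γ` has only `-`, the largest choice in the order. A
string above `γ` thus exceeds it before `a`, or first differs from it at `b` or later. -/
theorem prefixLT_or_agree {a b : ℕ} {α γ β : Str n}
    (h : ∀ m : Fin (n + 1), (m : ℕ) < a → γ m = α m)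
    (hb : ∀ m : Fin (n + 1), a ≤ (m : ℕ) → (m : ℕ) < b → γ m = false) (hβ : β = γ ∨ LexLT γ β) :
    PrefixLT a α β ∨ ∀ m : Fin (n + 1), (m : ℕ) < b → β m = γ m := by
  rcases hβ with rfl | ⟨m, hm, h1, h2⟩
  · exact Or.inr fun _ _ => rfl
  · by_cases hma : (m : ℕ) < a
    · refine Or.inl ⟨m, hma, fun l hl => ?_, (h m hma).symm.trans h1, h2⟩
      rw [← hm l hl, h l ((Fin.lt_def.mp hl).trans hma)]
    · refine Or.inr fun l hl => (hm l ?_).symm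
      by_contra hlm
      have := hb m (not_lt.mp hma) (by have := Fin.le_def.mp (not_lt.mp hlm); omega)
      simp [this] at h1

end Propagation

/-! ### Downward induction from descents to all strings -/

section Propagation

variable {k : Type*} [Field k] {n : ℕ} {F : Type*} [AddCommGroup F] [Module k F]

/-- The shape of the action of the generators on the Kazhdan-Lusztig basis. -/
structure IsCellular (c : Option (Fin n) → Matrix (Str n) (Str n) k) : Prop where
  row_eq_zero : ∀ i α β, ¬ IsDes i α → c i α β = 0
  support : ∀ i α β, c i α β ≠ 0 → β = refl i α ∨ β = α ∨ LexLT α β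
  refl_ne_zero : ∀ i α, IsDes i α → c i α (refl i α) ≠ 0

namespace IsCellular

variable {c : Option (Fin n) → Matrix (Str n) (Str n) k} {T : Option (Fin n) → Module.End k F}
  {ψ : Str n → F} {i j : Option (Fin n)} {α β : Str n}

/-- Off the descents row `α` of `c i` is zero, so `T i` kills `ψ α` and so does every `S * T i`. -/
theorem intertwines_mul_of_not_isDes (hc : IsCellular c) (A : Matrix (Str n) (Str n) k)
    (S : Module.End k F) (hi : ¬ IsDes i α) (h : Intertwines (c i) (T i) ψ α) :
    Intertwines (c i * A) (S * T i) ψ α :=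
  h.mul fun β hβ => absurd (hc.row_eq_zero i α β hi) hβ

/-- Passing from the reflected string to `α`. -/
theorem intertwines_of_refl (hc : IsCellular c) {A : Matrix (Str n) (Str n) k}
    {S : Module.End k F} (hj : IsAsc j α) (hdes : Intertwines (c j) (T j) ψ (refl j α))
    (hA : ∀ β, β = refl j α ∨ LexLT (refl j α) β → Intertwines A S ψ β)
    (h : Intertwines (c j * A) (S * T j) ψ (refl j α)) : Intertwines A S ψ α := by
  refine hdes.of_mul h ?_ fun β hne hβ => hA β ?_
  · simpa using hc.refl_ne_zero j (refl j α) ((isDes_refl j α).mpr hj)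
  · rcases hc.support _ _ _ hβ with h | h
    · rw [refl_refl] at h
      exact absurd h hne
    · exact h

theorem intertwines_mul (hc : IsCellular c) {A : Matrix (Str n) (Str n) k}
    {S : Module.End k F} (h : Intertwines (c j) (T j) ψ β)
    (hA : ∀ γ, γ = β ∨ LexLT β γ → Intertwines A S ψ γ)
    (hr : IsDes j β → Intertwines A S ψ (refl j β)) : Intertwines (c j * A) (S * T j) ψ β := by
  refine h.mul fun γ hγ => ?_
  rcases hc.support _ _ _ hγ with rfl | h'
  · refine hr ?_
    by_contra hd
    exact hγ (hc.row_eq_zero _ _ _ hd)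
  · exact hA γ h'

/-- Climbing `α < s_j α < s_i s_j α` turns the claim into the equation for the word `T i * T j * T
i` at the top. The braid relation replaces it by a word with `T j` applied first, which vanishes as
the top string is no descent for `j`. `hcl` keeps all intermediate strings above `α`. -/
theorem intertwines_of_braid (hc : IsCellular c)
    (hcb : c i * c j * c i - c i = c j * c i * c j - c j)
    (hTb : T i * T j * T i - T i = T j * T i * T j - T j)
    (ih : ∀ β, LexLT α β → ∀ i, Intertwines (c i) (T i) ψ β) (hj : IsAsc j α)
    (hi : IsAsc i (refl j α)) (hj' : ¬ IsDes j (refl i (refl j α)))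
    (hcl : ∀ β, β = refl i (refl j α) ∨ LexLT (refl i (refl j α)) β → IsDes j β →
      LexLT α (refl j β)) : Intertwines (c i) (T i) ψ α := by
  have h1 := hj.lexLT
  have h2 := h1.trans hi.lexLT
  refine hc.intertwines_of_refl hj (ih _ h1 j) ?_ ?_
  · rintro β (rfl | hβ)
    · exact ih _ h1 i
    · exact ih _ (h1.trans hβ) i
  refine hc.intertwines_of_refl hi (ih _ h2 i) ?_ ?_
  · intro β hβ
    have hαβ : LexLT α β := by
      rcases hβ with rfl | hβ
      · exact h2
      · exact h2.trans hβ
    refine hc.intertwines_mul (ih β hαβ j) ?_ fun hd => ih _ (hcl β hβ hd) i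
    rintro γ (rfl | hγ)
    · exact ih _ hαβ i
    · exact ih _ (hαβ.trans hγ) i
  · have e1 : c i * (c j * c i) = c j * (c i * c j) - c j + c i := by
      rw [← mul_assoc, ← mul_assoc, ← hcb, sub_add_cancel]
    have e2 : T i * T j * T i = T j * T i * T j - T j + T i := by
      rw [← hTb, sub_add_cancel]
    rw [e1, e2]
    exact ((hc.intertwines_mul_of_not_isDes _ _ hj' (ih _ h2 j)).sub (ih _ h2 j)).add (ih _ h2 i)

/-- As for the bulk braid relation, with one more reflection. The four-letter word at the top is
exchanged for words with `T i` applied first, which vanish there, plus `l` times a two-letter word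
already treated (`hji3`). -/
theorem intertwines_of_boundary_braid (hc : IsCellular c) {l : k}
    (hcb : c i * c j * c i * c j - l • (c i * c j) = c j * c i * c j * c i - l • (c j * c i))
    (hTb : T i * T j * T i * T j - l • (T i * T j) = T j * T i * T j * T i - l • (T j * T i))
    (ih : ∀ β, LexLT α β → ∀ i, Intertwines (c i) (T i) ψ β) (hj : IsAsc j α)
    (hi : IsAsc i (refl j α)) (hj' : IsAsc j (refl i (refl j α)))
    (hi' : ¬ IsDes i (refl j (refl i (refl j α))))
    (hcl : ∀ β, β = refl i (refl j α) ∨ LexLT (refl i (refl j α)) β → IsDes j β →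
      LexLT α (refl j β))
    (hcl' : ∀ β, β = refl j (refl i (refl j α)) ∨ LexLT (refl j (refl i (refl j α))) β →
      IsDes i β → LexLT α (refl i β) ∧ LexLT α (refl j (refl i β))) :
    Intertwines (c i) (T i) ψ α := by
  have h1 := hj.lexLT
  have h2 := h1.trans hi.lexLT
  have h3 := h2.trans hj'.lexLT
  have hge : ∀ {β γ}, LexLT α β → (γ = β ∨ LexLT β γ) → LexLT α γ := by
    rintro β γ h (rfl | hγ)
    · exact h
    · exact h.trans hγ
  have hji : ∀ β, LexLT α β → (IsDes j β → LexLT α (refl j β)) →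
      Intertwines (c j * c i) (T i * T j) ψ β := fun β hβ hd =>
    hc.intertwines_mul (ih β hβ j) (fun γ hγ => ih γ (hge hβ hγ) i) fun h => ih _ (hd h) i
  have hji2 : ∀ β, β = refl i (refl j α) ∨ LexLT (refl i (refl j α)) β →
      Intertwines (c j * c i) (T i * T j) ψ β := fun β hβ => hji β (hge h2 hβ) (hcl β hβ)
  have hji3 : ∀ β, β = refl j (refl i (refl j α)) ∨ LexLT (refl j (refl i (refl j α))) β →
      Intertwines (c j * c i) (T i * T j) ψ β := by
    rintro β (rfl | hβ)
    · exact hji2 _ (Or.inr hj'.lexLT)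
    · exact hji2 _ (Or.inr (hj'.lexLT.trans hβ))
  refine hc.intertwines_of_refl hj (ih _ h1 j) (fun β hβ => ih _ (hge h1 hβ) i) ?_
  refine hc.intertwines_of_refl hi (ih _ h2 i) hji2 ?_
  refine hc.intertwines_of_refl hj' (ih _ h3 j) ?_ ?_
  · intro β hβ
    refine hc.intertwines_mul (ih β (hge h3 hβ) i) ?_ ?_
    · rintro γ (rfl | hγ)
      · exact hji3 _ hβ
      · rcases hβ with rfl | hβ
        · exact hji3 _ (Or.inr hγ)
        · exact hji3 _ (Or.inr (hβ.trans hγ))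
    · intro hd
      exact hji _ (hcl' β hβ hd).1 fun _ => (hcl' β hβ hd).2
  · have e1 : c j * (c i * (c j * c i)) =
        c i * (c j * c i * c j) - l • (c i * c j) + l • (c j * c i) := by
      simp only [← mul_assoc]
      rw [hcb, sub_add_cancel]
    have e2 : T i * T j * T i * T j =
        T j * T i * T j * T i - l • (T j * T i) + l • (T i * T j) := by
      rw [← hTb, sub_add_cancel]
    rw [e1, e2]
    exact ((hc.intertwines_mul_of_not_isDes _ _ hi' (ih _ h3 i)).sub
      ((hc.intertwines_mul_of_not_isDes _ _ hi' (ih _ h3 i)).smul l)).add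
      ((hji3 _ (Or.inl rfl)).smul l)

end IsCellular

variable {c : Option (Fin n) → Matrix (Str n) (Str n) k} {T : Option (Fin n) → Module.End k F}
  {ψ : Str n → F}

/-- The equations at descents, together with the bulk equations at the largest string, imply all
equations. -/
theorem IsCellular.intertwines (hc : IsCellular c) {m : Option (Fin n) → k} {l : k}
    (hc_sq : ∀ i, c i * c i = m i • c i) (hT_sq : ∀ i, T i * T i = m i • T i)
    (hc_comm : ∀ i j, Far i j → c i * c j = c j * c i)
    (hT_comm : ∀ i j, Far i j → T i * T j = T j * T i)
    (hc_braid : ∀ i j : Fin n, i.succ = j.castSucc →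
      c (some i) * c (some j) * c (some i) - c (some i) =
        c (some j) * c (some i) * c (some j) - c (some j))
    (hT_braid : ∀ i j : Fin n, i.succ = j.castSucc →
      T (some i) * T (some j) * T (some i) - T (some i) =
        T (some j) * T (some i) * T (some j) - T (some j))
    (hc_bdry : ∀ i : Fin n, i.succ = Fin.last n →
      c (some i) * c none * c (some i) * c none - l • (c (some i) * c none) =
        c none * c (some i) * c none * c (some i) - l • (c none * c (some i)))
    (hT_bdry : ∀ i : Fin n, i.succ = Fin.last n →
      T (some i) * T none * T (some i) * T none - l • (T (some i) * T none) =
        T none * T (some i) * T none * T (some i) - l • (T none * T (some i)))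
    (hdes : ∀ i α, IsDes i α → Intertwines (c i) (T i) ψ α)
    (hminus : ∀ i : Fin n, Intertwines (c (some i)) (T (some i)) ψ (minusStr n))
    (α : Str n) (i : Option (Fin n)) : Intertwines (c i) (T i) ψ α := by
  revert i
  induction α using LexLT.wellFounded_swap.induction with
  | _ α ih =>
    replace ih : ∀ β, LexLT α β → ∀ i, Intertwines (c i) (T i) ψ β := ih
    intro i
    by_cases hi : IsDes i α
    · exact hdes i α hi
    by_cases hα : α = minusStr n
    · subst hα
      cases i with
      | none => exact absurd rfl hi
      | some i => exact hminus i
    obtain ⟨j, hj⟩ := exists_isAsc hα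
    have h1 := hj.lexLT
    rcases eq_or_far_or_adjacent i j with rfl | hfar | ⟨a, b, rfl, rfl, hab | hba⟩ |
      ⟨a, ha, ⟨rfl, rfl⟩ | ⟨rfl, rfl⟩⟩
    -- Equal generators: the quadratic relation suffices.
    · refine hc.intertwines_of_refl hj (ih _ h1 i) ?_ ?_
      · rintro β (rfl | hβ)
        · exact ih _ h1 i
        · exact ih _ (h1.trans hβ) i
      · rw [hc_sq, hT_sq]
        exact (ih _ h1 i).smul _
    -- Disjoint sites: commute, and use that `s_j α` is still no descent for `i`.
    · refine hc.intertwines_of_refl hj (ih _ h1 j) ?_ ?_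
      · rintro β (rfl | hβ)
        · exact ih _ h1 i
        · exact ih _ (h1.trans hβ) i
      · rw [← hc_comm i j hfar, hT_comm i j hfar]
        exact hc.intertwines_mul_of_not_isDes _ _ (by rwa [hfar.isDes_refl]) (ih _ h1 i)
    -- Local pattern `(+, +, -)`, climbing to `(+, -, +)` and `(-, +, +)`.
    · have hne1 : b.succ ≠ a.castSucc := by
        simp only [Fin.ext_iff, Fin.val_succ, Fin.val_castSucc, ne_eq] at hab ⊢
        omega
      have hne2 : b.succ ≠ a.succ := by rw [hab]; exact b.castSucc_lt_succ.ne'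
      have hne3 : a.castSucc ≠ b.castSucc := by rw [← hab]; exact a.castSucc_lt_succ.ne
      have hb1 : α a.succ = true := by rw [hab]; exact hj.1
      have hb2 : α b.succ = false := hj.2
      have ha1 : α a.castSucc = true := by
        by_contra h
        exact hi ⟨by simpa using h, hb1⟩
      set α₁ := refl (some b) α with hα₁
      have v1 : α₁ a.castSucc = true := by
        rw [hα₁, refl, swapStr_of_ne _ _ hne3 hne1.symm, ha1]
      have v2 : α₁ a.succ = false := by rw [hα₁, refl, hab, swapStr_castSucc, hb2]
      have w1 : refl (some a) α₁ a.castSucc = false := by rw [refl, swapStr_castSucc, v2]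
      have w2 : refl (some a) α₁ a.succ = true := by rw [refl, swapStr_succ, v1]
      have hsite : ∀ m : Fin (n + 1), IsSite (some b) m → (a : ℕ) + 1 ≤ m := by
        rintro m (rfl | rfl)
        · rw [← hab, Fin.val_succ]
        · have := congrArg Fin.val hab
          simp only [Fin.val_succ, Fin.val_castSucc] at this ⊢
          omega
      have hpre : ∀ m : Fin (n + 1), (m : ℕ) < a → refl (some a) α₁ m = α m := by
        intro m hm
        rw [refl_of_not_isSite, hα₁, refl_of_not_isSite]
        · exact fun h => absurd (hsite m h) (by omega)
        · rintro (rfl | rfl) <;> simp at hm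
      refine hc.intertwines_of_braid (hc_braid a b hab) (hT_braid a b hab) ih hj ⟨v1, v2⟩ ?_ ?_
      · rintro ⟨h, -⟩
        rw [← hab, w2] at h
        exact absurd h (by simp)
      · intro β hβ _
        have hfalse : ∀ m : Fin (n + 1), (a : ℕ) ≤ m →
            (m : ℕ) < a + 1 → refl (some a) α₁ m = false := by
          intro m h1 h2
          obtain rfl : m = a.castSucc := Fin.ext (by simp only [Fin.val_castSucc]; omega)
          exact w1
        rcases prefixLT_or_agree (a := a) (b := a + 1) hpre hfalse hβ with h | h
        · exact (h.refl (i := some b) fun m hm => (Nat.le_succ _).trans (hsite m hm)).lexLT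
        -- The place `a`, with `-` in `β` and `+` in `α`, is untouched by the reflection.
        · refine ⟨a.castSucc, fun m hm => ?_, ha1, ?_⟩
          · have hm' : (m : ℕ) < a := by simpa [Fin.lt_def] using hm
            rw [refl_of_not_isSite, h m (by omega), hpre m hm']
            exact fun hs => absurd (hsite m hs) (by omega)
          · rw [refl_of_not_isSite, h _ (by simp), w1]
            exact fun hs => absurd (hsite _ hs) (by simp)
    -- Local pattern `(+, -, -)`, climbing to `(-, +, -)` and `(-, -, +)`. A larger string agreeing
    -- with the top one at the sites of `b` has `(-, -)` there and is no descent.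
    · have hne1 : b.castSucc ≠ a.succ := by
        simp only [Fin.ext_iff, Fin.val_succ, Fin.val_castSucc, ne_eq] at hba ⊢
        omega
      have hne2 : b.castSucc ≠ a.castSucc := by rw [← hba]; exact b.castSucc_lt_succ.ne
      have hne3 : a.succ ≠ b.succ := by rw [hba]; exact a.castSucc_lt_succ.ne'
      have hb1 : α b.castSucc = true := hj.1
      have hb2 : α a.castSucc = false := by rw [← hba]; exact hj.2
      have ha1 : α a.succ = false := by
        by_contra h
        exact hi ⟨hb2, by simpa using h⟩
      set α₁ := refl (some b) α with hα₁
      have v1 : α₁ a.castSucc = true := by rw [hα₁, refl, ← hba, swapStr_succ, hb1]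
      have v2 : α₁ a.succ = false := by
        rw [hα₁, refl, swapStr_of_ne _ _ hne1.symm hne3, ha1]
      have v3 : α₁ b.castSucc = false := by rw [hα₁, refl, swapStr_castSucc, hba, hb2]
      have w1 : refl (some a) α₁ a.castSucc = false := by rw [refl, swapStr_castSucc, v2]
      have w2 : refl (some a) α₁ b.castSucc = false := by
        rw [refl, swapStr_of_ne _ _ hne2 hne1, v3]
      have hsite : ∀ m : Fin (n + 1), IsSite (some b) m → (b : ℕ) ≤ m := by
        rintro m (rfl | rfl) <;> simp
      have hpre : ∀ m : Fin (n + 1), (m : ℕ) < b → refl (some a) α₁ m = α m := by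
        intro m hm
        have := congrArg Fin.val hba
        simp only [Fin.val_succ, Fin.val_castSucc] at this
        rw [refl_of_not_isSite, hα₁, refl_of_not_isSite]
        · exact fun h => absurd (hsite m h) (by omega)
        · rintro (rfl | rfl) <;> simp only [Fin.val_succ, Fin.val_castSucc] at hm <;> omega
      refine hc.intertwines_of_braid (hc_braid b a hba).symm (hT_braid b a hba).symm ih hj
        ⟨v1, v2⟩ ?_ ?_
      · rintro ⟨-, h⟩
        rw [hba, w1] at h
        exact absurd h (by simp)
      · intro β hβ hd
        have hfalse : ∀ m : Fin (n + 1), (b : ℕ) ≤ m →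
            (m : ℕ) < b + 2 → refl (some a) α₁ m = false := by
          intro m h1 h2
          rcases Nat.lt_or_ge b m with h | h
          · obtain rfl : m = b.succ := Fin.ext (by simp only [Fin.val_succ]; omega)
            rw [hba, w1]
          · obtain rfl : m = b.castSucc := Fin.ext (by simp only [Fin.val_castSucc]; omega)
            exact w2
        rcases prefixLT_or_agree (a := b) (b := b + 2) hpre hfalse hβ with h | h
        · exact (h.refl (i := some b) hsite).lexLT
        · have := hd.2
          rw [h _ (by simp), hba, w1] at this
          exact absurd this (by simp)
    -- The last two letters are `(+, +)`, climbing to `(+, -)`, `(-, +)` and `(-, -)`.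
    · have hne : a.castSucc ≠ Fin.last n := by rw [← ha]; exact a.castSucc_lt_succ.ne
      have hlast : α (Fin.last n) = true := hj
      have hval : (a : ℕ) + 1 = n := by simpa using congrArg Fin.val ha
      have ha1 : α a.castSucc = true := by
        by_contra h
        exact hi ⟨by simpa using h, by rw [ha]; exact hlast⟩
      set α₁ := refl none α with hα₁
      have u1 : α₁ a.castSucc = true := by rw [hα₁, refl, flipStr_of_ne _ hne, ha1]
      have u2 : α₁ (Fin.last n) = false := by rw [hα₁, refl, flipStr_last, hlast]; rfl
      set α₂ := refl (some a) α₁ with hα₂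
      have v1 : α₂ a.castSucc = false := by rw [hα₂, refl, swapStr_castSucc, ha, u2]
      have v2 : α₂ (Fin.last n) = true := by rw [hα₂, refl, ← ha, swapStr_succ, u1]
      have w1 : refl none α₂ a.castSucc = false := by rw [refl, flipStr_of_ne _ hne, v1]
      have w2 : refl none α₂ (Fin.last n) = false := by rw [refl, flipStr_last, v2]; rfl
      have hsite : ∀ m : Fin (n + 1), IsSite (none : Option (Fin n)) m → (a : ℕ) + 1 ≤ m := by
        rintro m rfl
        simp [hval]
      have hsite' : ∀ m : Fin (n + 1), IsSite (some a) m → (a : ℕ) ≤ m := by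
        rintro m (rfl | rfl) <;> simp
      have hpre : ∀ m : Fin (n + 1), (m : ℕ) < a → α₂ m = α m := by
        intro m hm
        rw [hα₂, refl_of_not_isSite, hα₁, refl_of_not_isSite]
        · exact fun h => absurd (hsite m h) (by omega)
        · exact fun h => absurd (hsite' m h) (by omega)
      have hpre' : ∀ m : Fin (n + 1), (m : ℕ) < a → refl none α₂ m = α m := by
        intro m hm
        rw [refl_of_not_isSite _ fun h => absurd (hsite m h) (by omega), hpre m hm]
      refine hc.intertwines_of_boundary_braid (hc_bdry a ha) (hT_bdry a ha) ih hj
        ⟨u1, by rw [ha]; exact u2⟩ v2 ?_ ?_ ?_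
      · rintro ⟨-, h⟩
        rw [ha, w2] at h
        exact absurd h (by simp)
      · intro β hβ _
        have hfalse : ∀ m : Fin (n + 1), (a : ℕ) ≤ m →
            (m : ℕ) < a + 1 → α₂ m = false := by
          intro m h1 h2
          obtain rfl : m = a.castSucc := Fin.ext (by simp only [Fin.val_castSucc]; omega)
          exact v1
        rcases prefixLT_or_agree (a := a) (b := a + 1) hpre hfalse hβ with h | h
        · exact (h.refl (i := none) fun m hm => (Nat.le_succ _).trans (hsite m hm)).lexLT
        · refine ⟨a.castSucc, fun m hm => ?_, ha1, ?_⟩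
          · have hm' : (m : ℕ) < a := by simpa [Fin.lt_def] using hm
            rw [refl_of_not_isSite, h m (by omega), hpre m hm']
            exact fun hs => absurd (hsite m hs) (by omega)
          · rw [refl_of_not_isSite, h _ (by simp), v1]
            exact fun hs => absurd (hsite _ hs) (by simp)
      · intro β hβ hd
        have hfalse : ∀ m : Fin (n + 1), (a : ℕ) ≤ m →
            (m : ℕ) < a + 2 → refl none α₂ m = false := by
          intro m h1 h2
          rcases Nat.lt_or_ge a m with h | h
          · obtain rfl : m = Fin.last n := Fin.ext (by simp only [Fin.val_last]; omega)
            exact w2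
          · obtain rfl : m = a.castSucc := Fin.ext (by simp only [Fin.val_castSucc]; omega)
            exact w1
        rcases prefixLT_or_agree (a := a) (b := a + 2) hpre' hfalse hβ with h | h
        · have h' := h.refl (i := some a) hsite'
          exact ⟨h'.lexLT,
            (h'.refl (i := none) fun m hm => (Nat.le_succ _).trans (hsite m hm)).lexLT⟩
        · have := hd.2
          rw [h _ (by simp), ha, w2] at this
          exact absurd this (by simp)
    -- An ascent at the last two sites ends in `-`, a descent for the boundary generator, so this
    -- case is empty.
    · have h := hj.2
      rw [ha] at h
      exact absurd h hi

end Propagation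

/-! ### The systems of equations -/

section Systems

variable {k : Type*} [Field k] {n : ℕ} {X : KLType} {q qN κ ζ : kˣ}
  {C : Str n → Str n → ParamRing} {D : Set (Fin (n + 1) → k)}

/-- The action of a generator on the Kazhdan-Lusztig basis. -/
def genCoeff (q qN κ : kˣ) (C : Str n → Str n → ParamRing) (i : Option (Fin n)) :
    Matrix (Str n) (Str n) k :=
  klCoeff q qN κ C (gen q qN κ i)

theorem IsKLBasis.isCellular (hC : IsKLBasis n X C)
    (hX : ∀ M : ℕ+, X = KLType.BI M → qN = q ^ (M : ℕ)) : IsCellular (genCoeff q qN κ C) where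
  row_eq_zero i := (hC.klCoeff_gen hX i).1
  support i α β h := by
    by_contra hn
    obtain ⟨h1, h2, h3⟩ : β ≠ refl i α ∧ β ≠ α ∧ ¬ LexLT α β := by simpa using hn
    have hlt : LexLT β α := by
      rcases LexLT.trichotomous α β with h' | h' | h'
      · exact absurd h' h3
      · exact absurd h'.symm h2
      · exact h'
    refine h (((hC.klCoeff_gen hX i).2.2 α β hlt).trans (if_neg ?_))
    rintro ⟨rfl, -⟩
    exact h1 (refl_refl i β).symm
  refl_ne_zero i α hα := by
    rw [genCoeff, (hC.klCoeff_gen hX i).2.2 _ _ hα.lexLT, refl_refl,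
      if_pos ⟨rfl, (isAsc_refl i α).mpr hα⟩]
    exact Units.ne_zero _

theorem sum_smul_klVec (C : Str n → Str n → ParamRing) (a : Str n → k) :
    ∑ b, a b • klVec q qN κ C b = (klMatrix q qN κ C).mulVec a := by
  funext ε
  simp [klMatrix, Matrix.mulVec, dotProduct, mul_comm]

/-- An equation in `V^{⊗ N}` in terms of the components along the Kazhdan-Lusztig basis. -/
theorem IsKLBasis.gen_mulVec_eq_iff (hC : IsKLBasis n X C) (i : Option (Fin n)) (a b : Str n → k) :
    (gen q qN κ i).mulVec (∑ β, a β • klVec q qN κ C β) = ∑ β, b β • klVec q qN κ C β ↔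
      ∀ α, b α = ∑ β, genCoeff q qN κ C i α β * a β := by
  rw [sum_smul_klVec, sum_smul_klVec, Matrix.mulVec_mulVec, ← hC.klMatrix_mul_klCoeff,
    ← Matrix.mulVec_mulVec, (Matrix.mulVec_injective_of_isUnit hC.isUnit_klMatrix).eq_iff,
    eq_comm, funext_iff]
  rfl

/-- The components of a vector valued function, restricted to the domain. -/
def restrict (D : Set (Fin (n + 1) → k)) (Ψ : Str n → (Fin (n + 1) → k) → k) (α : Str n) : D → k :=
  fun z => Ψ α z

theorem intertwines_iff (hD : IsWeylDomain D) (c : Matrix (Str n) (Str n) k)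
    (Ψ : Str n → (Fin (n + 1) → k) → k) (i : Option (Fin n)) (α : Str n) :
    Intertwines c (hatOp q qN ζ hD i) (restrict D Ψ) α ↔
      ∀ z ∈ D, eHat q qN ζ i (Ψ α) z = ∑ β, c α β * Ψ β z := by
  rw [Intertwines, funext_iff, Subtype.forall]
  refine forall₂_congr fun z hz => ?_
  rw [eHat_eq_hatOp q qN ζ hD i (Ψ α) ⟨z, hz⟩]
  simp only [Finset.sum_apply, Pi.smul_apply, smul_eq_mul]
  rfl

theorem nonAffinePart_iff (hC : IsKLBasis n X C) (hD : IsWeylDomain D)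
    (Ψ : Str n → (Fin (n + 1) → k) → k) : NonAffinePart q qN κ ζ C D Ψ ↔
      ∀ i α, Intertwines (genCoeff q qN κ C i) (hatOp q qN ζ hD i) (restrict D Ψ) α := by
  have h : NonAffinePart q qN κ ζ C D Ψ ↔ ∀ i, ∀ z ∈ D,
      (gen q qN κ i).mulVec (∑ b, Ψ b z • klVec q qN κ C b) =
        ∑ b, eHat q qN ζ i (Ψ b) z • klVec q qN κ C b := by
    rw [Option.forall, and_comm]
    rfl
  rw [h]
  refine forall_congr' fun i => ?_
  simp only [intertwines_iff, hC.gen_mulVec_eq_iff]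
  exact ⟨fun h α z hz => h z hz α, fun h z hz α => h α z hz⟩

/-- At a descent the equation has the form of the non-trivial equations. -/
theorem IsKLBasis.sum_genCoeff_mul (hC : IsKLBasis n X C)
    (hX : ∀ M : ℕ+, X = KLType.BI M → qN = q ^ (M : ℕ)) {i : Option (Fin n)} {α : Str n}
    (hα : IsDes i α) (a : Str n → k) :
    ∑ β, genCoeff q qN κ C i α β * a β =
      -((heckePar q qN i : k) + ↑(heckePar q qN i)⁻¹) * a α + (↑(weight κ i)⁻¹ * a (refl i α) +
        ∑ β with LexLT α β ∧ ¬ IsDes i β, genCoeff q qN κ C i α β * a β) := by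
  obtain ⟨-, h2, h3⟩ := hC.klCoeff_gen (κ := κ) hX i
  have hne : α ≠ refl i α := hα.lexLT.ne.symm
  rw [Finset.sum_filter, ← Finset.add_sum_erase _ _ (Finset.mem_univ α),
    ← Finset.add_sum_erase _ _ (Finset.mem_erase.mpr ⟨hne.symm, Finset.mem_univ (refl i α)⟩),
    ← Finset.add_sum_erase _ _ (Finset.mem_univ α),
    ← Finset.add_sum_erase (Finset.univ.erase α)
      (fun β => if LexLT α β ∧ ¬ IsDes i β then genCoeff q qN κ C i α β * a β else 0)
      (Finset.mem_erase.mpr ⟨hne.symm, Finset.mem_univ (refl i α)⟩),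
    if_neg fun h => LexLT.irrefl α h.1, if_neg fun h => hα.lexLT.asymm h.1, zero_add, zero_add]
  congr 1
  · rw [genCoeff, h2 α α hα, if_pos rfl]
  congr 1
  · rw [genCoeff, h3 _ _ hα.lexLT, refl_refl, if_pos ⟨rfl, (isAsc_refl i α).mpr hα⟩]
  refine Finset.sum_congr rfl fun β hβ => ?_
  obtain ⟨hβ1, hβ2, -⟩ : β ≠ refl i α ∧ β ≠ α ∧ True := by simpa using hβ
  by_cases hd : IsDes i β
  · rw [if_neg fun h => h.2 hd, genCoeff, h2 α β hd, if_neg hβ2.symm, zero_mul]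
  rcases LexLT.trichotomous α β with h | h | h
  · rw [if_pos ⟨h, hd⟩]
  · exact absurd h.symm hβ2
  · rw [if_neg fun h' => h.asymm h'.1, genCoeff, h3 α β h, if_neg, zero_mul]
    rintro ⟨rfl, -⟩
    exact hβ1 (refl_refl i β).symm

/-- The common form of the non-trivial equations. -/
theorem IsKLBasis.intertwines_iff_of_isDes (hC : IsKLBasis n X C)
    (hX : ∀ M : ℕ+, X = KLType.BI M → qN = q ^ (M : ℕ)) (hD : IsWeylDomain D)
    (Ψ : Str n → (Fin (n + 1) → k) → k) {i : Option (Fin n)} {α : Str n} (hα : IsDes i α) :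
    Intertwines (genCoeff q qN κ C i) (hatOp q qN ζ hD i) (restrict D Ψ) α ↔ ∀ z ∈ D,
      eHat q qN ζ i (Ψ α) z + ((heckePar q qN i : k) + ↑(heckePar q qN i)⁻¹) * Ψ α z =
        ↑(weight κ i)⁻¹ * Ψ (refl i α) z +
          ∑ β with LexLT α β ∧ ¬ IsDes i β, genCoeff q qN κ C i α β * Ψ β z := by
  rw [intertwines_iff]
  refine forall₂_congr fun z _ => ?_
  rw [hC.sum_genCoeff_mul hX hα fun β => Ψ β z, neg_mul, ← sub_eq_neg_add, eq_sub_iff_add_eq]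

theorem le_iff_not_isDes (i : Fin n) (β : Str n) :
    β i.succ ≤ β i.castSucc ↔ ¬ IsDes (some i) β := by
  simp only [IsDes]
  cases β i.succ <;> cases β i.castSucc <;> simp

theorem last_eq_true_iff_not_isDes (β : Str n) : β (Fin.last n) = true ↔ ¬ IsDes none β := by
  simp [IsDes]

theorem nontrivial_iff (hC : IsKLBasis n X C)
    (hX : ∀ M : ℕ+, X = KLType.BI M → qN = q ^ (M : ℕ)) (hD : IsWeylDomain D)
    (Ψ : Str n → (Fin (n + 1) → k) → k) :
    NontrivialBulk q qN κ C D Ψ ∧ NontrivialBdry q qN κ ζ C D Ψ ↔ ∀ i α, IsDes i α →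
      Intertwines (genCoeff q qN κ C i) (hatOp q qN ζ hD i) (restrict D Ψ) α := by
  rw [Option.forall, and_comm]
  refine and_congr ?_ ?_
  · refine forall₂_congr fun α hα => ?_
    rw [hC.intertwines_iff_of_isDes hX hD Ψ (i := none) hα]
    simp only [last_eq_true_iff_not_isDes, heckePar, weight, Units.val_inv_eq_inv_val]
    rfl
  · refine forall₂_congr fun i α => ?_
    rw [← and_imp]
    refine forall_congr' fun hα => ?_
    rw [hC.intertwines_iff_of_isDes hX hD Ψ (i := some i) hα]
    simp only [le_iff_not_isDes, heckePar, weight, Units.val_inv_eq_inv_val, inv_one, Units.val_one,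
      one_mul]
    rfl

/-- At a string which is not a descent the equation is the trivial one. -/
theorem IsCellular.intertwines_iff_of_not_isDes {c : Option (Fin n) → Matrix (Str n) (Str n) k}
    (hc : IsCellular c) (hD : IsWeylDomain D) (Ψ : Str n → (Fin (n + 1) → k) → k)
    {i : Option (Fin n)} {α : Str n} (hα : ¬ IsDes i α) :
    Intertwines (c i) (hatOp q qN ζ hD i) (restrict D Ψ) α ↔
      ∀ z ∈ D, eHat q qN ζ i (Ψ α) z = 0 := by
  rw [intertwines_iff]
  refine forall₂_congr fun z _ => ?_
  rw [Finset.sum_eq_zero fun β _ => by rw [hc.row_eq_zero i α β hα, zero_mul]]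

theorem intertwines_of_nontrivial (hC : IsKLBasis n X C)
    (hX : ∀ M : ℕ+, X = KLType.BI M → qN = q ^ (M : ℕ)) (hD : IsWeylDomain D)
    (Ψ : Str n → (Fin (n + 1) → k) → k)
    (h : ∀ i α, IsDes i α →
      Intertwines (genCoeff q qN κ C i) (hatOp q qN ζ hD i) (restrict D Ψ) α)
    (h0 : ZeroEquations q D Ψ) (i : Option (Fin n)) (α : Str n) :
    Intertwines (genCoeff q qN κ C i) (hatOp q qN ζ hD i) (restrict D Ψ) α := by
  have hc := hC.isCellular (κ := κ) hX
  refine hc.intertwines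
    (m := fun i => -((heckePar q qN i : k) + (↑(heckePar q qN i)⁻¹ : k)))
    (l := (q : k) * ↑qN⁻¹ + ↑q⁻¹ * qN) (fun i => ?_) (hatOp_mul_hatOp q qN ζ hD)
    (fun i j hij => ?_) (fun i j hij => hij.hatOp_comm q qN ζ hD) (fun i j hij => ?_)
    (fun i j hij => hatOp_braid q qN ζ hD hij) (fun i hi => ?_)
    (fun i hi => hatOp_boundary_braid q qN ζ hD hi) h (fun i => ?_) α i
  · simp only [genCoeff]
    rw [← hC.klCoeff_mul, gen_mul_gen, klCoeff_smul]
  · simp only [genCoeff]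
    rw [← hC.klCoeff_mul, ← hC.klCoeff_mul, hij.gen_comm]
  · simp only [genCoeff, ← hC.klCoeff_mul]
    -- In the Temperley-Lieb quotient both sides of the braid relation are zero; the boundary
    -- relation below behaves in the same way.
    rw [gen_temperley_lieb_left _ _ _ hij, gen_temperley_lieb_right _ _ _ hij, sub_self, sub_self]
  · simp only [genCoeff, ← hC.klCoeff_mul, ← klCoeff_smul]
    rw [gen_blob_relation _ _ _ hi, mul_assoc (gen q qN κ none * _), mul_assoc (gen q qN κ none),
      ← mul_assoc (gen q qN κ (some i)), gen_blob_relation _ _ _ hi, Matrix.smul_mul,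
      Matrix.mul_smul, sub_self, sub_self]
  · rw [hc.intertwines_iff_of_not_isDes hD Ψ (by simp [IsDes, minusStr])]
    exact h0 i

end Systems

end BoundaryQKZ

end

theorem mainTheorem12 {k : Type*} [Field k] (n : ℕ) (X : BoundaryQKZ.KLType)
    (q qN κ ζ : kˣ) (hX : ∀ M : ℕ+, X = BoundaryQKZ.KLType.BI M → qN = q ^ (M : ℕ))
    (C : BoundaryQKZ.Str n → BoundaryQKZ.Str n → BoundaryQKZ.ParamRing)
    (hC : BoundaryQKZ.IsKLBasis n X C)
    (D : Set (Fin (n + 1) → k)) (hD : BoundaryQKZ.IsWeylDomain D)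
    (Ψ : BoundaryQKZ.Str n → (Fin (n + 1) → k) → k) :
    (BoundaryQKZ.NonAffinePart q qN κ ζ C D Ψ ↔
      BoundaryQKZ.NontrivialBulk q qN κ C D Ψ ∧
      BoundaryQKZ.NontrivialBdry q qN κ ζ C D Ψ ∧
      BoundaryQKZ.ZeroEquations q D Ψ) ∧
    (BoundaryQKZ.NontrivialBulk q qN κ C D Ψ →
      BoundaryQKZ.NontrivialBdry q qN κ ζ C D Ψ →
      BoundaryQKZ.ZeroEquations q D Ψ →
      BoundaryQKZ.TrivialEquations q qN ζ D Ψ) := by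
  have hc := hC.isCellular (κ := κ) hX
  have hnt := BoundaryQKZ.nontrivial_iff (κ := κ) (ζ := ζ) hC hX hD Ψ
  have hall := fun h => BoundaryQKZ.intertwines_of_nontrivial (κ := κ) (ζ := ζ) hC hX hD Ψ
    (hnt.mp h)
  rw [BoundaryQKZ.nonAffinePart_iff hC hD]
  refine ⟨⟨fun h => ?_, fun ⟨h1, h2, h3⟩ => hall ⟨h1, h2⟩ h3⟩, fun h1 h2 h3 => ?_⟩
  · obtain ⟨h1, h2⟩ := hnt.mpr fun i α _ => h i α
    refine ⟨h1, h2, fun i => ?_⟩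
    exact (hc.intertwines_iff_of_not_isDes (q := q) (qN := qN) (ζ := ζ) hD Ψ
      (by simp [BoundaryQKZ.IsDes, BoundaryQKZ.minusStr])).mp (h (some i) (BoundaryQKZ.minusStr n))
  · have h := hall ⟨h1, h2⟩ h3
    exact ⟨fun i α hα => (hc.intertwines_iff_of_not_isDes (q := q) (qN := qN) (ζ := ζ) hD Ψ
        ((BoundaryQKZ.le_iff_not_isDes i α).mp hα)).mp (h (some i) α),
      fun α hα => (hc.intertwines_iff_of_not_isDes (q := q) (qN := qN) (ζ := ζ) hD Ψ
        ((BoundaryQKZ.last_eq_true_iff_not_isDes α).mp hα)).mp (h none α)⟩
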